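/- Let $d\in\mathbb N$ and let $\Omega\subset\mathbb R^d$ be an arbitrary open set. **Colombeau algebra.** For compact $K\subset\Omega$, $l\in\mathbb N$ put $p_{K,l}(f)=\sup_{x\in K,|\alpha|\le l}|\partial^\alpha f(x)|$. Let $\mathcal F(\Omega)$ be the algebra of nets $(f_\varepsilon)_{\varepsilon\in(0,1]}$ in $C^\infty(\Omega;\mathbb C)$ such that for all $K,l$ there is $q\in\mathbb N$ with $p_{K,l}(f_\varepsilon)=o(\varepsilon^{-q})$ as $\varepsilon\to0$, let $\mathcal N(\Omega)$ be the ideal of nets such that $p_{K,l}(f_\varepsilon)=o(\varepsilon^{p})$ for all $K,l$ and all $p\in\mathbb N$, and let $\mathcal G(\Omega)=\mathcal F(\Omega)/\mathcal N(\Omega)$, with the obvious restriction maps $\mathcal G(\Omega)\to\mathcal G(\Omega')$ for open $\Omega'\subset\Omega$. **Mollifiers.** Let $\rho\in\mathcal S(\mathbb R^d)$ be even with $\int\rho=1$ and $\int x^m\rho(x)\,dx=0$ for all $m\in\mathbb N^d\setminus\{0\}$. Let $\chi\in\mathcal D(\mathbb R^d)$ with $0\le\chi\le1$, $\chi=1$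 on $\overline{B(0,1)}$ and $\chi=0$ off $B(0,2)$. Put $\rho_\varepsilon(x)=\varepsilon^{-d}\rho(x/\varepsilon)$ for $\varepsilon\in(0,1]$, $\theta_\varepsilon(x)=\rho_\varepsilon(x)\,\chi(x|\ln\varepsilon|)$ for $\varepsilon\in(0,1)$, and $\theta_1=1$. **The map $\iota_A$.** Let $(U_\lambda)_\lambda$ be a locally finite (in $\Omega$) open covering of $\Omega$ such that each $\overline{U_\lambda}$ is a compact subset of $\Omega$, and let $\psi_\lambda\in\mathcal D(\Omega)$ with $0\le\psi_\lambda\le1$ and $\psi_\lambda=1$ on a neighbourhood of $\overline{U_\lambda}$. Then $\iota_A:\mathcal D'(\Omega)\to\mathcal G(\Omega)$ is the map determined by $\iota_A(T)|_{U_\lambda}=\big[\big(((\psi_\lambda T)*\rho_\varepsilon)|_{U_\lambda}\big)_\varepsilon\big]$ in $\mathcal G(U_\lambda)$ for all $\lambda$ and $T$. **The map $\iota_S$.** For $\varepsilon\in(0,1]$ let $K_\varepsilon=\{x\in\Omega: d(x,\mathbb R^d\setminus\Omega)\ge\varepsilon,\ |x|\le1/\varepsilon\}$ (with $d(x,\emptyset)=\infty$),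 and let $\kappa_\varepsilon\in\mathcal D(\Omega)$ with $0\le\kappa_\varepsilon\le1$ and $\kappa_\varepsilon=1$ on $K_\varepsilon$. Then $\iota_S(T)=\big[\big((\kappa_\varepsilon T)*\theta_\varepsilon\big)_\varepsilon\big]$ in $\mathcal G(\Omega)$. **The map $\iota_S'$.** Let $(V_\mu)_\mu$ be a locally finite (in $\Omega$) open covering of $\Omega$ such that each $\overline{V_\mu}$ is a compact subset of $\Omega$, and let $e_\mu\in(0,1]$ be such that $\theta_\varepsilon(y-\cdot)\in\mathcal D(\Omega)$ for all $\varepsilon\in(0,e_\mu^2]$ and $y\in V_\mu$. For $T\in\mathcal D'(\Omega)$ and $y\in V_\mu$ put $T^\mu_\varepsilon(y)=\langle T,\theta_\varepsilon(y-\cdot)\rangle$ for $\varepsilon\in(0,e_\mu^2]$ and $T^\mu_\varepsilon=T^\mu_{e_\mu^2}$ for $\varepsilon\in(e_\mu^2,1]$. Then $\iota_S':\mathcal D'(\Omega)\to\mathcal G(\Omega)$ is the map determined by $\iota_S'(T)|_{V_\mu}=[(T^\mu_\varepsilon)_\varepsilon]$ in $\mathcal G(V_\mu)$ for all $\mu$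 and $T$. **Proposition.** For every choice of the above data with the same $\rho$, each of the three prescriptions is well defined (the nets involved are moderate) and determines exactly one map $\mathcal D'(\Omega)\to\mathcal G(\Omega)$; these maps are linear, and $$\iota_A=\iota_S=\iota_S'.$$ -/

import Mathlib

open Set Topology TopologicalSpace MeasureTheory
open scoped ContDiff

namespace Colombeau

/-- The space `ℝ^d` with its Euclidean norm. -/
abbrev Space (d : ℕ) : Type := EuclideanSpace ℝ (Fin d)

/-- The parameter set `(0, 1]`. -/
abbrev Eps : Type := Set.Ioc (0 : ℝ) 1

/-- Nets `(f_ε)`, `ε ∈ (0, 1]`, of functions. A function on an open set `Ω` is represented by a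
function on `ℝ^d` whose values outside `Ω` are never looked at (see `moderate`, `negligible`). -/
abbrev Net (d : ℕ) : Type := Eps → Space d → ℂ

/-- `p_{K,l}(f_ε) = o(ε ^ r)` for `ε → 0`, where `p_{K,l}(f)` is the supremum over `K` of the norms
of all derivatives of `f` of order at most `l`. -/
def SeminormLittleO {d : ℕ} (K : Set (Space d)) (l : ℕ) (f : Net d) (r : ℤ) : Prop :=
  ∀ c : ℝ, 0 < c → ∃ η : ℝ, 0 < η ∧ ∀ ε : Eps, (ε : ℝ) < η → ∀ i ≤ l, ∀ x ∈ K,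
    ‖iteratedFDeriv ℝ i (f ε) x‖ ≤ c * (ε : ℝ) ^ r

/-- Moderate nets of smooth functions on `Ω`. -/
def IsModerate {d : ℕ} (Ω : Opens (Space d)) (f : Net d) : Prop :=
  (∀ ε, ContDiffOn ℝ ∞ (f ε) (Ω : Set (Space d))) ∧
    ∀ (l : ℕ) (K : Set (Space d)), IsCompact K → K ⊆ Ω → ∃ q : ℕ, SeminormLittleO K l f (-(q : ℤ))

/-- Negligible nets of smooth functions on `Ω`. -/
def IsNegligible {d : ℕ} (Ω : Opens (Space d)) (f : Net d) : Prop :=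
  (∀ ε, ContDiffOn ℝ ∞ (f ε) (Ω : Set (Space d))) ∧
    ∀ (l : ℕ) (K : Set (Space d)), IsCompact K → K ⊆ Ω → ∀ p : ℕ, SeminormLittleO K l f (p : ℤ)

section Algebra

variable {d : ℕ} {Ω Ω' : Opens (Space d)} {K : Set (Space d)} {l : ℕ} {f g : Net d}

theorem SeminormLittleO.mono {r s : ℤ} (h : SeminormLittleO K l f r) (hrs : s ≤ r) :
    SeminormLittleO K l f s := by
  intro c hc
  obtain ⟨η, hη, H⟩ := h c hc
  refine ⟨η, hη, fun ε hε i hi x hx => (H ε hε i hi x hx).trans ?_⟩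
  exact mul_le_mul_of_nonneg_left (zpow_le_zpow_right_of_le_one₀ ε.2.1 ε.2.2 hrs) hc.le

theorem SeminormLittleO.add (hK : K ⊆ Ω)
    (hf : ∀ ε, ContDiffOn ℝ ∞ (f ε) (Ω : Set (Space d)))
    (hg : ∀ ε, ContDiffOn ℝ ∞ (g ε) (Ω : Set (Space d))) {r : ℤ}
    (h : SeminormLittleO K l f r) (h' : SeminormLittleO K l g r) :
    SeminormLittleO K l (f + g) r := by
  intro c hc
  obtain ⟨η, hη, H⟩ := h (c / 2) (by positivity)
  obtain ⟨η', hη', H'⟩ := h' (c / 2) (by positivity)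
  refine ⟨min η η', lt_min hη hη', fun ε hε i hi x hx => ?_⟩
  have hx' : (Ω : Set (Space d)) ∈ 𝓝 x := Ω.isOpen.mem_nhds (hK hx)
  have e : iteratedFDeriv ℝ i ((f + g) ε) x
      = iteratedFDeriv ℝ i (f ε) x + iteratedFDeriv ℝ i (g ε) x :=
    iteratedFDeriv_add_apply
      (((hf ε).contDiffAt hx').of_le (by exact_mod_cast le_top))
      (((hg ε).contDiffAt hx').of_le (by exact_mod_cast le_top))
  have h1 := H ε (hε.trans_le (min_le_left _ _)) i hi x hx
  have h2 := H' ε (hε.trans_le (min_le_right _ _)) i hi x hx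
  rw [e]
  refine (norm_add_le _ _).trans ((add_le_add h1 h2).trans (le_of_eq ?_))
  ring

theorem SeminormLittleO.mul (hK : K ⊆ Ω)
    (hf : ∀ ε, ContDiffOn ℝ ∞ (f ε) (Ω : Set (Space d)))
    (hg : ∀ ε, ContDiffOn ℝ ∞ (g ε) (Ω : Set (Space d))) {r s : ℤ}
    (h : SeminormLittleO K l f r) (h' : SeminormLittleO K l g s) :
    SeminormLittleO K l (f * g) (r + s) := by
  intro c hc
  obtain ⟨η, hη, H⟩ := h (c / 2 ^ l) (by positivity)
  obtain ⟨η', hη', H'⟩ := h' 1 one_pos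
  refine ⟨min η η', lt_min hη hη', fun ε hε i hi x hx => ?_⟩
  have hxΩ : x ∈ (Ω : Set (Space d)) := hK hx
  have h0 : (0 : ℝ) < ε := ε.2.1
  have e : ∀ (j : ℕ) (u : Space d → ℂ),
      iteratedFDerivWithin ℝ j u Ω x = iteratedFDeriv ℝ j u x := fun j u =>
    iteratedFDerivWithin_of_isOpen j Ω.isOpen hxΩ
  have key := norm_iteratedFDerivWithin_mul_le (hf ε) (hg ε) Ω.isOpen.uniqueDiffOn hxΩ
    (n := i) (by exact_mod_cast le_top)
  simp only [e] at key
  have e' : (f * g) ε = fun y => f ε y * g ε y := rfl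
  rw [e']
  refine key.trans ?_
  calc _ ≤ ∑ j ∈ Finset.range (i + 1),
        (i.choose j : ℝ) * ((c / 2 ^ l * (ε : ℝ) ^ r) * (1 * (ε : ℝ) ^ s)) := by
        refine Finset.sum_le_sum fun j hj => ?_
        have hj' : j ≤ i := Nat.lt_succ_iff.mp (Finset.mem_range.mp hj)
        have h1 := H ε (hε.trans_le (min_le_left _ _)) j (hj'.trans hi) x hx
        have h2 := H' ε (hε.trans_le (min_le_right _ _)) (i - j) ((Nat.sub_le _ _).trans hi) x hx
        rw [mul_assoc]
        refine mul_le_mul_of_nonneg_left ?_ (by positivity)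
        exact mul_le_mul h1 h2 (norm_nonneg _) (by positivity)
    _ = 2 ^ i * ((c / 2 ^ l * (ε : ℝ) ^ r) * (1 * (ε : ℝ) ^ s)) := by
        rw [← Finset.sum_mul]
        congr 1
        exact_mod_cast Nat.sum_range_choose i
    _ ≤ 2 ^ l * ((c / 2 ^ l * (ε : ℝ) ^ r) * (1 * (ε : ℝ) ^ s)) := by
        refine mul_le_mul_of_nonneg_right ?_ (by positivity)
        exact pow_le_pow_right₀ one_le_two hi
    _ = c * (ε : ℝ) ^ (r + s) := by
        rw [zpow_add₀ h0.ne']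
        field_simp

theorem IsModerate.add (hf : IsModerate Ω f) (hg : IsModerate Ω g) : IsModerate Ω (f + g) := by
  refine ⟨fun ε => (hf.1 ε).add (hg.1 ε), fun l K hK hKΩ => ?_⟩
  obtain ⟨q, hq⟩ := hf.2 l K hK hKΩ
  obtain ⟨q', hq'⟩ := hg.2 l K hK hKΩ
  exact ⟨max q q', (hq.mono (by simp)).add hKΩ hf.1 hg.1 (hq'.mono (by simp))⟩

theorem IsModerate.mul (hf : IsModerate Ω f) (hg : IsModerate Ω g) : IsModerate Ω (f * g) := by
  refine ⟨fun ε => (hf.1 ε).mul (hg.1 ε), fun l K hK hKΩ => ?_⟩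
  obtain ⟨q, hq⟩ := hf.2 l K hK hKΩ
  obtain ⟨q', hq'⟩ := hg.2 l K hK hKΩ
  exact ⟨q + q', (hq.mul hKΩ hf.1 hg.1 hq').mono (by push_cast; linarith)⟩

theorem IsModerate.const (z : ℂ) : IsModerate Ω (fun _ _ => z) := by
  refine ⟨fun ε => contDiffOn_const, fun l K _ _ => ⟨1, fun c hc => ?_⟩⟩
  refine ⟨c / (‖z‖ + 1), by positivity, fun ε hε i _ x _ => ?_⟩
  have h0 : (0 : ℝ) < ε := ε.2.1
  have h1 : ‖iteratedFDeriv ℝ i (fun _ : Space d => z) x‖ ≤ ‖z‖ := by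
    rcases Nat.eq_zero_or_pos i with rfl | hi
    · simp
    · rw [iteratedFDeriv_const_of_ne hi.ne']
      simp
  refine h1.trans ?_
  rw [lt_div_iff₀ (by positivity)] at hε
  have : c * (ε : ℝ) ^ (-((1 : ℕ) : ℤ)) = c / ε := by simp [div_eq_mul_inv]
  rw [this, le_div_iff₀ h0]
  nlinarith [norm_nonneg z]

theorem IsNegligible.add (hf : IsNegligible Ω f) (hg : IsNegligible Ω g) :
    IsNegligible Ω (f + g) :=
  ⟨fun ε => (hf.1 ε).add (hg.1 ε), fun l K hK hKΩ p =>
    (hf.2 l K hK hKΩ p).add hKΩ hf.1 hg.1 (hg.2 l K hK hKΩ p)⟩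

theorem IsNegligible.mul (hf : IsModerate Ω f) (hg : IsNegligible Ω g) :
    IsNegligible Ω (f * g) := by
  refine ⟨fun ε => (hf.1 ε).mul (hg.1 ε), fun l K hK hKΩ p => ?_⟩
  obtain ⟨q, hq⟩ := hf.2 l K hK hKΩ
  exact (hq.mul hKΩ hf.1 hg.1 (hg.2 l K hK hKΩ (q + p))).mono (by push_cast; linarith)

theorem IsNegligible.zero : IsNegligible Ω (0 : Net d) := by
  refine ⟨fun ε => contDiffOn_const, fun l K _ _ p c hc => ⟨1, one_pos, fun ε _ i _ x _ => ?_⟩⟩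
  have h0 : (0 : ℝ) < ε := ε.2.1
  have : iteratedFDeriv ℝ i ((0 : Net d) ε) x = 0 := by
    have := iteratedFDeriv_fun_zero (𝕜 := ℝ) (E := Space d) (F := ℂ) (n := i)
    exact congrFun this x
  rw [this, norm_zero]
  positivity

theorem IsModerate.restrict (h : Ω' ≤ Ω) (hf : IsModerate Ω f) : IsModerate Ω' f :=
  ⟨fun ε => (hf.1 ε).mono h, fun l K hK hKΩ => hf.2 l K hK (hKΩ.trans h)⟩

theorem IsNegligible.restrict (h : Ω' ≤ Ω) (hf : IsNegligible Ω f) : IsNegligible Ω' f :=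
  ⟨fun ε => (hf.1 ε).mono h, fun l K hK hKΩ => hf.2 l K hK (hKΩ.trans h)⟩

end Algebra

/-- The algebra of moderate nets on `Ω`. -/
def moderate {d : ℕ} (Ω : Opens (Space d)) : Subalgebra ℂ (Net d) where
  carrier := {f | IsModerate Ω f}
  mul_mem' := IsModerate.mul
  add_mem' := IsModerate.add
  algebraMap_mem' := IsModerate.const

/-- The ideal of negligible nets in the algebra of moderate nets on `Ω`. -/
def negligible {d : ℕ} (Ω : Opens (Space d)) : Ideal (moderate Ω) where
  carrier := {f | IsNegligible Ω (f : Net d)}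
  add_mem' := IsNegligible.add
  zero_mem' := IsNegligible.zero
  smul_mem' := fun f _ hg => IsNegligible.mul f.2 hg

/-- The simplified Colombeau algebra `𝒢(Ω)`. -/
def ColombeauAlgebra {d : ℕ} (Ω : Opens (Space d)) : Type := moderate Ω ⧸ negligible Ω

noncomputable instance {d : ℕ} (Ω : Opens (Space d)) : CommRing (ColombeauAlgebra Ω) :=
  inferInstanceAs (CommRing (moderate Ω ⧸ negligible Ω))

noncomputable instance {d : ℕ} (Ω : Opens (Space d)) : Algebra ℂ (ColombeauAlgebra Ω) :=
  inferInstanceAs (Algebra ℂ (moderate Ω ⧸ negligible Ω))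

/-- The class in `𝒢(Ω)` of a moderate net. -/
def cls {d : ℕ} {Ω : Opens (Space d)} (f : Net d) (hf : f ∈ moderate Ω) : ColombeauAlgebra Ω :=
  Ideal.Quotient.mk (negligible Ω) ⟨f, hf⟩

/-- The restriction map `𝒢(Ω) → 𝒢(Ω')` for `Ω' ⊆ Ω`, `[(f_ε)] ↦ [(f_ε|_{Ω'})]`. -/
noncomputable def restriction {d : ℕ} {Ω Ω' : Opens (Space d)} (h : Ω' ≤ Ω) :
    ColombeauAlgebra Ω →ₐ[ℂ] ColombeauAlgebra Ω' :=
  Ideal.quotientMapₐ (negligible Ω')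
    (Subalgebra.inclusion (fun _ hf => IsModerate.restrict h hf : moderate Ω ≤ moderate Ω'))
    (fun _ hf => IsNegligible.restrict h hf)

theorem restriction_cls {d : ℕ} {Ω Ω' : Opens (Space d)} (h : Ω' ≤ Ω) (f : Net d)
    (hf : f ∈ moderate Ω) :
    restriction h (cls f hf) = cls f (IsModerate.restrict h hf) := rfl

/-- `g` is a smooth function with compact support contained in `Ω`. -/
def IsTest {d : ℕ} {F : Type*} [NormedAddCommGroup F] [NormedSpace ℝ F]
    (Ω : Opens (Space d)) (g : Space d → F) : Prop :=
  ContDiff ℝ ∞ g ∧ HasCompactSupport g ∧ tsupport g ⊆ Ω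

open Classical in
/-- `⟨T, g⟩` for a real-valued test function `g` on `Ω` (and `0` if `g` is not one). -/
noncomputable def pairingReal {d : ℕ} {Ω : Opens (Space d)} (T : Distribution Ω ℂ ⊤)
    (g : Space d → ℝ) : ℂ :=
  if h : IsTest Ω g then T ⟨g, h.1, h.2.1, h.2.2⟩ else 0

/-- `⟨T, g⟩` for a complex-valued test function `g` on `Ω`. A complex distribution is in Mathlib an
`ℝ`-linear map from real-valued test functions to `ℂ`; here it is extended `ℂ`-linearly. -/
noncomputable def pairing {d : ℕ} {Ω : Opens (Space d)} (T : Distribution Ω ℂ ⊤)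
    (g : Space d → ℂ) : ℂ :=
  pairingReal T (fun x => (g x).re) + Complex.I * pairingReal T (fun x => (g x).im)

/-- `ρ ∈ 𝒮(ℝ^d)` is even, has integral `1`, and all its moments of positive order vanish. -/
structure IsMollifier {d : ℕ} (ρ : SchwartzMap (Space d) ℂ) : Prop where
  even : ∀ x, ρ (-x) = ρ x
  integral_eq_one : ∫ x, ρ x = 1
  moment_eq_zero : ∀ m : Fin d → ℕ, m ≠ 0 → ∫ x, ((∏ i, x i ^ m i : ℝ) : ℂ) * ρ x = 0

/-- `χ ∈ 𝒟(ℝ^d)`, `0 ≤ χ ≤ 1`, `χ = 1` on the closed unit ball, `χ = 0` off the open ball of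
radius `2`. -/
structure IsCutoff {d : ℕ} (χ : Space d → ℝ) : Prop where
  isTest : IsTest ⊤ χ
  mem_Icc : ∀ x, χ x ∈ Icc (0 : ℝ) 1
  eq_one : ∀ x ∈ Metric.closedBall (0 : Space d) 1, χ x = 1
  eq_zero : ∀ x ∉ Metric.ball (0 : Space d) 2, χ x = 0

/-- `ρ_ε(x) = ε^{-d} ρ(x / ε)`. -/
noncomputable def rhoNet {d : ℕ} (ρ : SchwartzMap (Space d) ℂ) : Net d :=
  fun ε x => ((1 / (ε : ℝ) ^ d : ℝ) : ℂ) * ρ ((ε : ℝ)⁻¹ • x)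

open Classical in
/-- `θ_ε(x) = ρ_ε(x) χ(|ln ε| x)` for `ε ∈ (0, 1)`, and `θ_1 = 1`. -/
noncomputable def thetaNet {d : ℕ} (ρ : SchwartzMap (Space d) ℂ) (χ : Space d → ℝ) : Net d :=
  fun ε x => if (ε : ℝ) = 1 then 1 else rhoNet ρ ε x * (χ (|Real.log ε| • x) : ℂ)

/-- `K_ε = {x ∈ Ω | d(x, ℝ^d \ Ω) ≥ ε, d(x, 0) ≤ 1 / ε}`; the distance to the empty set is `∞`. -/
def exhaustion {d : ℕ} (Ω : Opens (Space d)) (ε : Eps) : Set (Space d) :=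
  {x | x ∈ Ω ∧ ENNReal.ofReal ε ≤ Metric.infEDist x (Ω : Set (Space d))ᶜ ∧ dist x 0 ≤ 1 / (ε : ℝ)}

/-- Cutoffs `κ_ε ∈ 𝒟(Ω)`, `0 ≤ κ_ε ≤ 1`, `κ_ε = 1` on `K_ε`. -/
structure IsCutoffNet {d : ℕ} (Ω : Opens (Space d)) (κ : Eps → Space d → ℝ) : Prop where
  isTest : ∀ ε, IsTest Ω (κ ε)
  mem_Icc : ∀ ε x, κ ε x ∈ Icc (0 : ℝ) 1
  eq_one : ∀ ε, ∀ x ∈ exhaustion Ω ε, κ ε x = 1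

/-- A locally finite open covering `(U_λ)` of `Ω` such that the closure of each `U_λ` is a compact
subset of `Ω`. -/
structure IsCovering {d : ℕ} (Ω : Opens (Space d)) {L : Type*} (U : L → Opens (Space d)) :
    Prop where
  isCompact_closure : ∀ l, IsCompact (closure (U l : Set (Space d)))
  closure_subset : ∀ l, closure (U l : Set (Space d)) ⊆ Ω
  covers : ∀ x ∈ Ω, ∃ l, x ∈ U l
  locallyFinite : ∀ x ∈ Ω, ∃ W ∈ 𝓝 x, {l | ((U l : Set (Space d)) ∩ W).Nonempty}.Finite

theorem IsCovering.le {d : ℕ} {Ω : Opens (Space d)} {L : Type*} {U : L → Opens (Space d)}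
    (h : IsCovering Ω U) (l : L) : U l ≤ Ω := subset_closure.trans (h.closure_subset l)

/-- `ψ_λ ∈ 𝒟(Ω)`, `0 ≤ ψ_λ ≤ 1`, `ψ_λ = 1` on a neighbourhood of the closure of `U_λ`. -/
structure IsPlateau {d : ℕ} (Ω : Opens (Space d)) {L : Type*} (U : L → Opens (Space d))
    (ψ : L → Space d → ℝ) : Prop where
  isTest : ∀ l, IsTest Ω (ψ l)
  mem_Icc : ∀ l x, ψ l x ∈ Icc (0 : ℝ) 1
  eq_one : ∀ l, ∀ᶠ x in 𝓝ˢ (closure (U l : Set (Space d))), ψ l x = 1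

/-- Numbers `e_λ ∈ (0, 1]` such that for all `ε ∈ (0, e_λ ^ 2]` and `y ∈ U_λ` the function
`x ↦ θ_ε(y - x)` belongs to `𝒟(Ω)`. -/
def IsThreshold {d : ℕ} (Ω : Opens (Space d)) (θ : Net d) {L : Type*} (U : L → Opens (Space d))
    (e : L → Eps) : Prop :=
  ∀ l, ∀ ε : Eps, (ε : ℝ) ≤ (e l : ℝ) ^ 2 → ∀ y ∈ U l, IsTest Ω (fun x => θ ε (y - x))

/-- The net `(aT) * g_ε` for a cutoff `a ∈ 𝒟(Ω)`, a distribution `T` on `Ω` and smooth `g_ε`: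
`((aT) * g_ε)(y) = ⟨aT, g_ε(y - ·)⟩ = ⟨T, a g_ε(y - ·)⟩`. The cutoff may depend on `ε`. -/
noncomputable def cutConv {d : ℕ} {Ω : Opens (Space d)} (a : Eps → Space d → ℝ) (g : Net d)
    (T : Distribution Ω ℂ ⊤) : Net d :=
  fun ε y => pairing T (fun x => (a ε x : ℂ) * g ε (y - x))

/-- The square of an element of `(0, 1]`. -/
def Eps.sq (e : Eps) : Eps := ⟨(e : ℝ) ^ 2, pow_pos e.2.1 2, pow_le_one₀ e.2.1.le e.2.2⟩

/-- `T_ε(y) = ⟨T, θ_ε(y - ·)⟩` for `ε ≤ e ^ 2`, and `T_ε = T_{e ^ 2}` for `ε > e ^ 2`. -/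
noncomputable def localNet {d : ℕ} {Ω : Opens (Space d)} (θ : Net d) (e : Eps)
    (T : Distribution Ω ℂ ⊤) : Net d :=
  fun ε y => pairing T (fun x => θ (min ε e.sq) (y - x))

/-- `u : 𝒟'(Ω) → 𝒢(Ω)` is the map `T ↦ [(N(T)_ε)]`. -/
def IsGivenBy {d : ℕ} {Ω : Opens (Space d)} (N : Distribution Ω ℂ ⊤ → Net d)
    (u : Distribution Ω ℂ ⊤ → ColombeauAlgebra Ω) : Prop :=
  ∀ T, ∃ h : N T ∈ moderate Ω, u T = cls (N T) h

/-- `u : 𝒟'(Ω) → 𝒢(Ω)` is glued from the maps `T ↦ [(N_λ(T)_ε)] ∈ 𝒢(U_λ)`, that is,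
`u(T)|_{U_λ} = [(N_λ(T)_ε)]` in `𝒢(U_λ)` for all `λ` and `T`. -/
def IsGluedFrom {d : ℕ} {Ω : Opens (Space d)} {L : Type*} {U : L → Opens (Space d)}
    (hU : IsCovering Ω U) (N : L → Distribution Ω ℂ ⊤ → Net d)
    (u : Distribution Ω ℂ ⊤ → ColombeauAlgebra Ω) : Prop :=
  ∀ l T, ∃ h : N l T ∈ moderate (U l), restriction (hU.le l) (u T) = cls (N l T) h

/-- `u` is the map `ι_A` : it is glued from the maps `T ↦ [((ψ_λ T) * ρ_ε)|_{U_λ}]`. -/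
def IsIotaA {d : ℕ} {Ω : Opens (Space d)} (ρ : SchwartzMap (Space d) ℂ) {L : Type*}
    {U : L → Opens (Space d)} (hU : IsCovering Ω U) (ψ : L → Space d → ℝ)
    (u : Distribution Ω ℂ ⊤ → ColombeauAlgebra Ω) : Prop :=
  IsGluedFrom hU (fun l => cutConv (fun _ => ψ l) (rhoNet ρ)) u

/-- `u` is the map `ι_S` : `T ↦ [((κ_ε T) * θ_ε)]`. -/
def IsIotaS {d : ℕ} {Ω : Opens (Space d)} (ρ : SchwartzMap (Space d) ℂ) (χ : Space d → ℝ)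
    (κ : Eps → Space d → ℝ) (u : Distribution Ω ℂ ⊤ → ColombeauAlgebra Ω) : Prop :=
  IsGivenBy (cutConv κ (thetaNet ρ χ)) u

/-- `u` is the map `ι'_S` : it is glued from the maps `T ↦ [(⟨T, θ_ε(y - ·)⟩)_ε]`, `y ∈ V_λ`. -/
def IsIotaS' {d : ℕ} {Ω : Opens (Space d)} (ρ : SchwartzMap (Space d) ℂ) (χ : Space d → ℝ)
    {L : Type*} {V : L → Opens (Space d)} (hV : IsCovering Ω V) (e : L → Eps)
    (u : Distribution Ω ℂ ⊤ → ColombeauAlgebra Ω) : Prop :=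
  IsGluedFrom hV (fun l => localNet (thetaNet ρ χ) (e l)) u

end Colombeau

/-! The net `(κ_ε T) * θ_ε` represents all three embeddings at once, so no gluing of sections is
needed. Two facts make this work. Locality: `θ_ε` is supported in the ball of radius `2 / |ln ε|`,
which shrinks to a point. If a cutoff `a_ε` equals `1` on a fixed neighbourhood of a set for small
`ε`, then `(a_ε T) * θ_ε` coincides there with `⟨T, θ_ε(y - ·)⟩` (`EventuallyOneNear.mul_thetaNet`).
Both `κ_ε` and `ψ_λ` are such cutoffs near the closure of `U_λ`, so on each set of a covering the
nets built from `θ_ε` agree exactly for small `ε`. Rapid decay: `θ_ε - ρ_ε` vanishes for `|x| < 1 /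
|ln ε|`. Outside that ball `|x / ε|` is at least of order `ε ^ (-1/2)`, so Schwartz decay of `ρ`
beats every power of `ε`, derivatives included (`uniformBigO_thetaNet_sub_rhoNet`). Since `T` has
finite order on a compact set, bounds on `g_ε` pass to `(ψ_λ T) * g_ε`
(`exists_seminormLittleO_conv`); hence replacing `ρ_ε` by `θ_ε` costs only a negligible net.
Moderateness and negligibility are local, so these comparisons on the members of a covering suffice,
and an element of the algebra is determined by its restrictions (`IsCovering.ext`). -/

namespace Colombeau

/-! ### Linearity and finite order of the pairing with test functions -/

section Pairing

variable {d : ℕ} {Ω : Opens (Space d)}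

theorem tsupport_re_subset (g : Space d → ℂ) : tsupport (fun x => (g x).re) ⊆ tsupport g :=
  closure_mono fun x hx h0 => hx (by simp [h0])

theorem IsTest.re {g : Space d → ℂ} (h : IsTest Ω g) : IsTest Ω (fun x => (g x).re) := by
  have hs := tsupport_re_subset g
  exact ⟨Complex.reCLM.contDiff.comp h.1, h.2.1.of_isClosed_subset (isClosed_tsupport _) hs,
    hs.trans h.2.2⟩

theorem tsupport_im_subset (g : Space d → ℂ) : tsupport (fun x => (g x).im) ⊆ tsupport g :=
  closure_mono fun x hx h0 => hx (by simp [h0])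

theorem IsTest.im {g : Space d → ℂ} (h : IsTest Ω g) : IsTest Ω (fun x => (g x).im) := by
  have hs := tsupport_im_subset g
  exact ⟨Complex.imCLM.contDiff.comp h.1, h.2.1.of_isClosed_subset (isClosed_tsupport _) hs,
    hs.trans h.2.2⟩

theorem IsTest.add {F : Type*} [NormedAddCommGroup F] [NormedSpace ℝ F] {f g : Space d → F}
    (hf : IsTest Ω f) (hg : IsTest Ω g) : IsTest Ω (fun x => f x + g x) :=
  ⟨hf.1.add hg.1, hf.2.1.add hg.2.1, (tsupport_add f g).trans (union_subset hf.2.2 hg.2.2)⟩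

theorem IsTest.const_smul {F : Type*} [NormedAddCommGroup F] [NormedSpace ℝ F] {f : Space d → F}
    (c : ℝ) (hf : IsTest Ω f) : IsTest Ω (fun x => c • f x) := by
  have hs : tsupport (fun x => c • f x) ⊆ tsupport f :=
    closure_mono fun x hx h0 => hx (by simp [h0])
  exact ⟨hf.1.const_smul c, hf.2.1.of_isClosed_subset (isClosed_tsupport _) hs, hs.trans hf.2.2⟩

theorem pairingReal_of_isTest (T : Distribution Ω ℂ ⊤) {g : Space d → ℝ} (h : IsTest Ω g) :
    pairingReal T g = T ⟨g, h.1, h.2.1, h.2.2⟩ := dif_pos h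

theorem pairingReal_add (T : Distribution Ω ℂ ⊤) {f g : Space d → ℝ} (hf : IsTest Ω f)
    (hg : IsTest Ω g) :
    pairingReal T (fun x => f x + g x) = pairingReal T f + pairingReal T g := by
  rw [pairingReal_of_isTest T hf, pairingReal_of_isTest T hg,
    pairingReal_of_isTest T (hf.add hg), ← map_add]
  rfl

theorem pairingReal_smul (T : Distribution Ω ℂ ⊤) (c : ℝ) {f : Space d → ℝ} (hf : IsTest Ω f) :
    pairingReal T (fun x => c • f x) = c • pairingReal T f := by
  rw [pairingReal_of_isTest T hf, pairingReal_of_isTest T (hf.const_smul c), ← map_smul]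
  rfl

theorem pairing_add (T : Distribution Ω ℂ ⊤) {f g : Space d → ℂ} (hf : IsTest Ω f)
    (hg : IsTest Ω g) :
    pairing T (fun x => f x + g x) = pairing T f + pairing T g := by
  have h1 := pairingReal_add T hf.re hg.re
  have h2 := pairingReal_add T hf.im hg.im
  simp only [pairing, Complex.add_re, Complex.add_im, h1, h2]
  ring

theorem pairing_smul (T : Distribution Ω ℂ ⊤) (c : ℝ) {f : Space d → ℂ} (hf : IsTest Ω f) :
    pairing T (fun x => c • f x) = c • pairing T f := by
  have h1 := pairingReal_smul T c hf.re
  have h2 := pairingReal_smul T c hf.im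
  simp only [pairing, Complex.smul_re, Complex.smul_im, h1, h2, smul_add, mul_smul_comm]

theorem pairingReal_add_left (S T : Distribution Ω ℂ ⊤) (g : Space d → ℝ) :
    pairingReal (S + T) g = pairingReal S g + pairingReal T g := by
  unfold pairingReal
  split_ifs
  · rfl
  · simp

theorem pairingReal_smul_left (c : ℂ) (T : Distribution Ω ℂ ⊤) (g : Space d → ℝ) :
    pairingReal (c • T) g = c * pairingReal T g := by
  unfold pairingReal
  split_ifs
  · rfl
  · simp

theorem pairing_add_left (S T : Distribution Ω ℂ ⊤) (g : Space d → ℂ) :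
    pairing (S + T) g = pairing S g + pairing T g := by
  simp only [pairing, pairingReal_add_left]
  ring

theorem pairing_smul_left (c : ℂ) (T : Distribution Ω ℂ ⊤) (g : Space d → ℂ) :
    pairing (c • T) g = c * pairing T g := by
  simp only [pairing, pairingReal_smul_left]
  ring

/-- On test functions supported in a fixed compact set a distribution has finite order. -/
theorem exists_norm_pairingReal_le (T : Distribution Ω ℂ ⊤) {K : Set (Space d)}
    (hK : IsCompact K) (hKΩ : K ⊆ Ω) :
    ∃ C : ℝ, 0 ≤ C ∧ ∃ m : ℕ, ∀ g : Space d → ℝ, IsTest Ω g → tsupport g ⊆ K →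
      ∀ B : ℝ, 0 ≤ B → (∀ i ≤ m, ∀ x ∈ K, ‖iteratedFDeriv ℝ i g x‖ ≤ B) →
        ‖pairingReal T g‖ ≤ C * B := by
  let K' : Compacts (Space d) := ⟨K, hK⟩
  have hK' : (K' : Set (Space d)) ⊆ Ω := hKΩ
  let A := (T : TestFunction Ω ℝ ⊤ →ₗ[ℝ] ℂ).comp
    (TestFunction.ofSupportedInCLM (F := ℝ) (n := ⊤) ℝ hK').toLinearMap
  have hA : Continuous A :=
    (map_continuous T).comp (TestFunction.continuous_ofSupportedIn (F := ℝ) (n := ⊤) hK')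
  obtain ⟨s, C, -, hC⟩ := Seminorm.bound_of_continuous
    (ContDiffMapSupportedIn.withSeminorms ℝ (Space d) ℝ ⊤ K')
    ((normSeminorm ℝ ℂ).comp A) (continuous_norm.comp hA)
  -- The order is the largest index among the finitely many seminorms that dominate `T` on functions
  -- supported in `K`.
  refine ⟨C, C.2, s.sup id, fun g hg hgK B hB h => ?_⟩
  let g' : ContDiffMapSupportedIn (Space d) ℝ ⊤ K' :=
    ContDiffMapSupportedIn.of_support_subset hg.1 ((subset_tsupport _).trans hgK)
  have e : pairingReal T g = A g' := by
    rw [pairingReal_of_isTest T hg]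
    rfl
  rw [e]
  refine (hC g').trans ?_
  refine mul_le_mul_of_nonneg_left ?_ C.2
  refine Seminorm.finset_sup_apply_le hB fun i hi => ?_
  exact (ContDiffMapSupportedIn.seminorm_top_le_iff ℝ hB i g').2
    fun x hx => h i (Finset.le_sup (f := id) hi) x hx

theorem exists_norm_pairing_le (T : Distribution Ω ℂ ⊤) {K : Set (Space d)}
    (hK : IsCompact K) (hKΩ : K ⊆ Ω) :
    ∃ C : ℝ, 0 ≤ C ∧ ∃ m : ℕ, ∀ g : Space d → ℂ, IsTest Ω g → tsupport g ⊆ K →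
      ∀ B : ℝ, 0 ≤ B → (∀ i ≤ m, ∀ x ∈ K, ‖iteratedFDeriv ℝ i g x‖ ≤ B) →
        ‖pairing T g‖ ≤ C * B := by
  obtain ⟨C, hC, m, H⟩ := exists_norm_pairingReal_le T hK hKΩ
  refine ⟨2 * C, by positivity, m, fun g hg hgK B hB h => ?_⟩
  have h1 : ‖pairingReal T (fun x => (g x).re)‖ ≤ C * B := by
    refine H _ hg.re ((tsupport_re_subset g).trans hgK) B hB
      fun i hi x hx => ?_
    refine (Complex.reCLM.norm_iteratedFDeriv_comp_left hg.1.contDiffAt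
      (n := i) (by exact_mod_cast le_top)).trans ?_
    rw [Complex.reCLM_norm, one_mul]
    exact h i hi x hx
  have h2 : ‖pairingReal T (fun x => (g x).im)‖ ≤ C * B := by
    refine H _ hg.im ((tsupport_im_subset g).trans hgK) B hB
      fun i hi x hx => ?_
    refine (Complex.imCLM.norm_iteratedFDeriv_comp_left hg.1.contDiffAt
      (n := i) (by exact_mod_cast le_top)).trans ?_
    rw [Complex.imCLM_norm, one_mul]
    exact h i hi x hx
  refine (norm_add_le _ _).trans ?_
  rw [norm_mul, Complex.norm_I, one_mul]
  linarith

end Pairing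

/-! ### Linearity and sup bounds of the convolution `(aT) * g` -/

section Conv

variable {d : ℕ} {Ω : Opens (Space d)}

/-- The convolution `(aT) * g` of a distribution cut off by `a` with a smooth function. -/
noncomputable def conv (T : Distribution Ω ℂ ⊤) (a : Space d → ℝ) (g : Space d → ℂ)
    (y : Space d) : ℂ :=
  pairing T (fun x => (a x : ℂ) * g (y - x))

variable (T : Distribution Ω ℂ ⊤) {a : Space d → ℝ} {f g : Space d → ℂ}

theorem tsupport_ofReal_mul_subset (a : Space d → ℝ) (h : Space d → ℂ) :
    tsupport (fun x => (a x : ℂ) * h x) ⊆ tsupport a :=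
  closure_mono fun x hx h0 => hx (by simp [h0])

theorem IsTest.ofReal_mul_comp_sub (ha : IsTest Ω a) (hg : ContDiff ℝ ∞ g) (y : Space d) :
    IsTest Ω (fun x => (a x : ℂ) * g (y - x)) :=
  ⟨(Complex.ofRealCLM.contDiff.comp ha.1).mul (hg.comp (contDiff_const.sub contDiff_id)),
    ha.2.1.of_isClosed_subset (isClosed_tsupport _) (tsupport_ofReal_mul_subset _ _),
    (tsupport_ofReal_mul_subset _ _).trans ha.2.2⟩

theorem conv_add (ha : IsTest Ω a) (hf : ContDiff ℝ ∞ f) (hg : ContDiff ℝ ∞ g) (y : Space d) :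
    conv T a (fun z => f z + g z) y = conv T a f y + conv T a g y := by
  unfold conv
  rw [← pairing_add T (ha.ofReal_mul_comp_sub hf y) (ha.ofReal_mul_comp_sub hg y)]
  simp only [mul_add]

theorem conv_smul (ha : IsTest Ω a) (hf : ContDiff ℝ ∞ f) (c : ℝ) (y : Space d) :
    conv T a (fun z => c • f z) y = c • conv T a f y := by
  unfold conv
  rw [← pairing_smul T c (ha.ofReal_mul_comp_sub hf y)]
  simp only [mul_smul_comm]

theorem conv_sub (ha : IsTest Ω a) (hf : ContDiff ℝ ∞ f) (hg : ContDiff ℝ ∞ g) (y : Space d) :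
    conv T a (fun z => f z - g z) y = conv T a f y - conv T a g y := by
  have h := conv_add T ha (hf.sub hg) hg y
  simp only [sub_add_cancel] at h
  rw [h, add_sub_cancel_right]

theorem norm_iteratedFDeriv_comp_const_sub {F : Type*} [NormedAddCommGroup F] [NormedSpace ℝ F]
    (g : Space d → F) (i : ℕ) (y x : Space d) :
    ‖iteratedFDeriv ℝ i (fun x => g (y - x)) x‖ = ‖iteratedFDeriv ℝ i g (y - x)‖ := by
  have h := (LinearIsometryEquiv.neg ℝ (E := Space d)).norm_iteratedFDeriv_comp_right
    (fun z => g (y + z)) x i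
  rw [iteratedFDeriv_comp_add_left] at h
  simpa [Function.comp_def, sub_eq_add_neg] using h

/-- By the Leibniz rule the derivatives of `a`, bounded on its compact support, are absorbed in `C`;
only finitely many derivatives of `g` on `y - supp a` remain. -/
theorem exists_norm_conv_le (ha : IsTest Ω a) :
    ∃ C : ℝ, 0 ≤ C ∧ ∃ m : ℕ, ∀ g : Space d → ℂ, ContDiff ℝ ∞ g → ∀ y, ∀ B : ℝ, 0 ≤ B →
      (∀ i ≤ m, ∀ x ∈ tsupport a, ‖iteratedFDeriv ℝ i g (y - x)‖ ≤ B) → ‖conv T a g y‖ ≤ C * B := by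
  obtain ⟨C, hC, m, H⟩ := exists_norm_pairing_le T ha.2.1 ha.2.2
  have hac : ContDiff ℝ ∞ (fun x => (a x : ℂ)) := Complex.ofRealCLM.contDiff.comp ha.1
  have hb : ∀ i, ∃ A : ℝ, ∀ x ∈ tsupport a, ‖iteratedFDeriv ℝ i (fun x => (a x : ℂ)) x‖ ≤ A :=
    fun i => IsCompact.exists_bound_of_continuousOn ha.2.1
      (hac.continuous_iteratedFDeriv (by exact_mod_cast le_top)).continuousOn
  choose A hA using hb
  let A' := ∑ i ∈ Finset.range (m + 1), |A i|
  have hA' : ∀ i ≤ m, ∀ x ∈ tsupport a,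
      ‖iteratedFDeriv ℝ i (fun x => (a x : ℂ)) x‖ ≤ A' := fun i hi x hx =>
    (hA i x hx).trans ((le_abs_self _).trans (Finset.single_le_sum (f := fun i => |A i|)
      (fun _ _ => abs_nonneg _) (Finset.mem_range.2 (Nat.lt_succ_of_le hi))))
  have hA0 : 0 ≤ A' := Finset.sum_nonneg fun _ _ => abs_nonneg _
  refine ⟨C * (2 ^ m * A'), by positivity, m, fun g hg y B hB h => ?_⟩
  rw [mul_assoc]
  refine H _ (ha.ofReal_mul_comp_sub hg y) (tsupport_ofReal_mul_subset _ _) _ (by positivity)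
    fun i hi x hx => ?_
  refine (norm_iteratedFDeriv_mul_le hac (hg.comp (contDiff_const.sub contDiff_id)) x (n := i)
    (by exact_mod_cast le_top)).trans ?_
  calc _ ≤ ∑ j ∈ Finset.range (i + 1), (i.choose j : ℝ) * (A' * B) := by
        refine Finset.sum_le_sum fun j hj => ?_
        have hj' : j ≤ i := Nat.lt_succ_iff.mp (Finset.mem_range.mp hj)
        rw [mul_assoc]
        refine mul_le_mul_of_nonneg_left ?_ (by positivity)
        refine mul_le_mul (hA' j (hj'.trans hi) x hx) ?_ (norm_nonneg _) hA0
        refine (norm_iteratedFDeriv_comp_const_sub g (i - j) y x).le.trans ?_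
        exact h _ ((Nat.sub_le _ _).trans hi) x hx
    _ = 2 ^ i * (A' * B) := by
        rw [← Finset.sum_mul]
        congr 1
        exact_mod_cast Nat.sum_range_choose i
    _ ≤ 2 ^ m * A' * B := by
        rw [mul_assoc]
        refine mul_le_mul_of_nonneg_right ?_ (by positivity)
        exact pow_le_pow_right₀ one_le_two hi

end Conv

/-! ### Taylor remainder in `C^j` norms -/

section Taylor

variable {E : Type} [NormedAddCommGroup E] [NormedSpace ℝ E] [FiniteDimensional ℝ E]

/-- The first order Taylor remainder of a smooth function is small in all `C^j` norms. -/
theorem exists_norm_iteratedFDeriv_remainder_le (j : ℕ) :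
    ∀ {F : Type} [NormedAddCommGroup F] [NormedSpace ℝ F] {g : E → F}, ContDiff ℝ ∞ g →
      ∀ (R : ℝ) {c : ℝ}, 0 < c → ∃ δ > 0, ∀ h : E, ‖h‖ < δ → ∀ z, ‖z‖ ≤ R →
        ‖iteratedFDeriv ℝ j (fun z => g (z + h) - g z - fderiv ℝ g z h) z‖ ≤ c * ‖h‖ := by
  induction j with
  | zero =>
    intro F _ _ g hg R c hc
    have : ProperSpace E := FiniteDimensional.proper_real E
    have hd : Continuous (fderiv ℝ g) := hg.continuous_fderiv (by simp)
    have hu := (isCompact_closedBall (0 : E) (R + 1)).uniformContinuousOn_of_continuous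
      hd.continuousOn
    obtain ⟨δ, hδ, H⟩ := Metric.uniformContinuousOn_iff.1 hu c hc
    -- The bound `1` keeps the segment from `z` to `z + h` in the ball of radius `R + 1`, where
    -- `fderiv ℝ g` is uniformly continuous.
    refine ⟨min δ 1, lt_min hδ one_pos, fun h hh z hz => ?_⟩
    have hhδ := hh.trans_le (min_le_left _ _)
    have hh1 := hh.trans_le (min_le_right _ _)
    rw [norm_iteratedFDeriv_zero]
    have key := Convex.norm_image_sub_le_of_norm_fderiv_le' (𝕜 := ℝ) (f := g) (C := c)
      (φ := fderiv ℝ g z) (s := Metric.closedBall z ‖h‖) (x := z) (y := z + h)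
      (fun x _ => hg.differentiable (by simp) x) (fun x hx => ?_) (convex_closedBall _ _)
      (by simp) (by simp)
    · simpa using key
    · rw [← dist_eq_norm]
      rw [mem_closedBall_iff_norm] at hx
      refine (H x ?_ z ?_ ?_).le
      · rw [mem_closedBall_zero_iff]
        have := norm_le_norm_add_norm_sub' x z
        linarith
      · rw [mem_closedBall_zero_iff]
        linarith
      · rw [dist_eq_norm]
        linarith
  | succ j ih =>
    intro F _ _ g hg R c hc
    have hg' : ContDiff ℝ ∞ (fderiv ℝ g) := hg.fderiv_right (by simp)
    obtain ⟨δ, hδ, H⟩ := ih hg' R hc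
    refine ⟨δ, hδ, fun h hh z hz => ?_⟩
    -- By symmetry of the second derivative, the derivative of the remainder of `g` is the remainder
    -- of `fderiv ℝ g`. The target space changes here, which is why the induction quantifies over
    -- `F`.
    have e : fderiv ℝ (fun z => g (z + h) - g z - fderiv ℝ g z h)
        = fun z => fderiv ℝ g (z + h) - fderiv ℝ g z - fderiv ℝ (fderiv ℝ g) z h := by
      funext z
      have d1 : HasFDerivAt (fun z => g (z + h)) (fderiv ℝ g (z + h)) z :=
        (hasFDerivAt_comp_add_right h).2 (hg.differentiable (by simp) (z + h)).hasFDerivAt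
      have d2 : HasFDerivAt g (fderiv ℝ g z) z := (hg.differentiable (by simp) z).hasFDerivAt
      have d3 : HasFDerivAt (fderiv ℝ g) (fderiv ℝ (fderiv ℝ g) z) z :=
        (hg'.differentiable (by simp) z).hasFDerivAt
      have d4 := d3.clm_apply (hasFDerivAt_const h z)
      rw [((d1.fun_sub d2).fun_sub d4).fderiv]
      congr 1
      ext v
      have hsymm : IsSymmSndFDerivAt ℝ g z :=
        (contDiff_infty.1 hg 2).contDiffAt.isSymmSndFDerivAt (by simp)
      simpa using (hsymm h v).symm
    rw [← norm_iteratedFDeriv_fderiv, e]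
    exact H h hh z hz

end Taylor

/-! ### Smoothness of `(aT) * g` and bounds for its derivatives -/

section ConvSmooth

variable {d : ℕ} {Ω : Opens (Space d)} (T : Distribution Ω ℂ ⊤) {a : Space d → ℝ}
  {f g : Space d → ℂ}

theorem contDiff_fderiv_apply_const (hg : ContDiff ℝ ∞ g) (v : Space d) :
    ContDiff ℝ ∞ (fun z => fderiv ℝ g z v) :=
  (hg.fderiv_right (by simp)).clm_apply contDiff_const

/-- The error of the linear approximation is the convolution with the Taylor remainder of `g`, and
by `exists_norm_conv_le` finitely many `C^j` norms of that remainder control it. -/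
theorem hasFDerivAt_conv (ha : IsTest Ω a) (hg : ContDiff ℝ ∞ g) (y : Space d) :
    ∃ D : Space d →L[ℝ] ℂ, HasFDerivAt (conv T a g) D y ∧
      ∀ v, D v = conv T a (fun z => fderiv ℝ g z v) y := by
  let D₀ : Space d →ₗ[ℝ] ℂ :=
    { toFun := fun v => conv T a (fun z => fderiv ℝ g z v) y
      map_add' := fun v w => by
        simp only [map_add]
        exact conv_add T ha (contDiff_fderiv_apply_const hg v) (contDiff_fderiv_apply_const hg w) y
      map_smul' := fun c v => by
        simp only [map_smul]
        exact conv_smul T ha (contDiff_fderiv_apply_const hg v) c y }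
  refine ⟨LinearMap.toContinuousLinearMap D₀, ?_, fun v => rfl⟩
  obtain ⟨C, hC, m, H⟩ := exists_norm_conv_le T ha
  obtain ⟨R, hR⟩ := ha.2.1.isBounded.exists_norm_le
  rw [hasFDerivAt_iff_isLittleO_nhds_zero, Asymptotics.isLittleO_iff]
  intro c hc
  have hc' : 0 < c / (C + 1) := by positivity
  -- The arguments `y - x` with `x` in the support of `a` stay in the ball of radius `‖y‖ + R`.
  choose δ hδ Hδ using fun j : ℕ =>
    exists_norm_iteratedFDeriv_remainder_le j hg (‖y‖ + R) hc'
  have hball : ∀ᶠ h : Space d in 𝓝 0, ∀ j ∈ Finset.range (m + 1), ‖h‖ < δ j := by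
    rw [Finset.eventually_all]
    intro j _
    filter_upwards [Metric.ball_mem_nhds (0 : Space d) (hδ j)] with h hh
    exact mem_ball_zero_iff.1 hh
  filter_upwards [hball] with h hh
  have hgh : ContDiff ℝ ∞ (fun z => g (z + h)) := hg.comp (contDiff_id.add contDiff_const)
  have e : conv T a g (y + h) - conv T a g y - D₀ h
      = conv T a (fun z => g (z + h) - g z - fderiv ℝ g z h) y := by
    rw [conv_sub T ha (hgh.sub hg) (contDiff_fderiv_apply_const hg h), conv_sub T ha hgh hg]
    congr 2
    simp only [conv, sub_add_eq_add_sub]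
  change ‖conv T a g (y + h) - conv T a g y - D₀ h‖ ≤ _
  rw [e]
  refine (H _ ((hgh.sub hg).sub (contDiff_fderiv_apply_const hg h)) y (c / (C + 1) * ‖h‖)
    (by positivity) fun j hj x hx => ?_).trans ?_
  · refine Hδ j h (hh j (Finset.mem_range.2 (Nat.lt_succ_of_le hj))) _ ?_
    exact (norm_sub_le _ _).trans (add_le_add le_rfl (hR x hx))
  · rw [← mul_assoc]
    refine mul_le_mul_of_nonneg_right ?_ (norm_nonneg _)
    rw [mul_div_assoc', div_le_iff₀ (by positivity)]
    nlinarith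

theorem fderiv_conv_apply (ha : IsTest Ω a) (hg : ContDiff ℝ ∞ g) (y v : Space d) :
    fderiv ℝ (conv T a g) y v = conv T a (fun z => fderiv ℝ g z v) y := by
  obtain ⟨D, hD, h⟩ := hasFDerivAt_conv T ha hg y
  rw [hD.fderiv, h]

theorem contDiff_conv (ha : IsTest Ω a) (hg : ContDiff ℝ ∞ g) : ContDiff ℝ ∞ (conv T a g) := by
  rw [contDiff_infty]
  intro n
  induction n generalizing g with
  | zero =>
    refine contDiff_zero.2 (continuous_iff_continuousAt.2 fun y => ?_)
    obtain ⟨D, hD, -⟩ := hasFDerivAt_conv T ha hg y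
    exact hD.continuousAt
  | succ n ih =>
    push_cast
    rw [contDiff_succ_iff_fderiv_apply]
    refine ⟨fun y => ?_, by simp, fun v => ?_⟩
    · obtain ⟨D, hD, -⟩ := hasFDerivAt_conv T ha hg y
      exact hD.differentiableAt
    · simp only [fderiv_conv_apply T ha hg]
      exact ih (contDiff_fderiv_apply_const hg v)

/-- Each derivative of the convolution falls on `g` and costs one more derivative of it, so `C` and
`m` do not depend on `i`. -/
theorem exists_norm_iteratedFDeriv_conv_le (ha : IsTest Ω a) :
    ∃ C : ℝ, 0 ≤ C ∧ ∃ m : ℕ, ∀ (i : ℕ) (g : Space d → ℂ), ContDiff ℝ ∞ g → ∀ B : ℝ, 0 ≤ B →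
      (∀ j ≤ m + i, ∀ z, ‖iteratedFDeriv ℝ j g z‖ ≤ B) →
        ∀ y, ‖iteratedFDeriv ℝ i (conv T a g) y‖ ≤ C * B := by
  obtain ⟨C, hC, m, H⟩ := exists_norm_conv_le T ha
  refine ⟨C, hC, m, fun i => ?_⟩
  induction i with
  | zero =>
    intro g hg B hB h y
    rw [norm_iteratedFDeriv_zero]
    exact H g hg y B hB fun i hi x _ => h i hi _
  | succ i ih =>
    intro g hg B hB h y
    refine ContinuousMultilinearMap.opNorm_le_bound (by positivity) fun v => ?_
    have hc : ContDiff ℝ ∞ (fderiv ℝ (conv T a g)) := (contDiff_conv T ha hg).fderiv_right (by simp)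
    have hg' : ContDiff ℝ ∞ (fderiv ℝ g) := hg.fderiv_right (by simp)
    -- Peeling off the last direction turns `g` into a directional derivative of `g`, to which the
    -- induction hypothesis applies.
    have e : iteratedFDeriv ℝ (i + 1) (conv T a g) y v
        = iteratedFDeriv ℝ i (conv T a (fun z => fderiv ℝ g z (v (Fin.last i)))) y
            (Fin.init v) := by
      rw [iteratedFDeriv_succ_apply_right]
      have h1 := (ContinuousLinearMap.apply ℝ ℂ (v (Fin.last i))).iteratedFDeriv_comp_left
        (f := fderiv ℝ (conv T a g)) (x := y) (i := i) hc.contDiffAt (by exact_mod_cast le_top)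
      have h2 : (ContinuousLinearMap.apply ℝ ℂ (v (Fin.last i))) ∘ fderiv ℝ (conv T a g)
          = conv T a (fun z => fderiv ℝ g z (v (Fin.last i))) := by
        funext y
        exact fderiv_conv_apply T ha hg y _
      rw [h2] at h1
      rw [h1]
      rfl
    rw [e]
    refine (ContinuousMultilinearMap.le_opNorm _ _).trans ?_
    have key := ih (fun z => fderiv ℝ g z (v (Fin.last i)))
      (contDiff_fderiv_apply_const hg _) (‖v (Fin.last i)‖ * B) (by positivity) (fun j hj z => ?_) y
    · rw [Fin.prod_univ_castSucc, ← mul_assoc, mul_right_comm]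
      refine (mul_le_mul_of_nonneg_right key (by positivity)).trans (le_of_eq ?_)
      simp only [Fin.init]
      ring
    · refine (norm_iteratedFDeriv_clm_apply_const hg'.contDiffAt (n := j)
        (by exact_mod_cast le_top)).trans ?_
      rw [norm_iteratedFDeriv_fderiv]
      exact mul_le_mul_of_nonneg_left (h _ (by omega) z) (norm_nonneg _)

end ConvSmooth

/-! ### Uniform powers of `ε` and their transfer to convolutions -/

section Bounds

variable {d : ℕ} {f g : Net d} {n : ℕ} {r : ℤ}

/-- All derivatives of `f_ε` of order at most `n` are `O(ε ^ r)` uniformly on the whole space. -/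
def UniformBigO (f : Net d) (n : ℕ) (r : ℤ) : Prop :=
  ∃ C : ℝ, 0 ≤ C ∧ ∀ ε : Eps, (ε : ℝ) < 1 → ∀ i ≤ n, ∀ x,
    ‖iteratedFDeriv ℝ i (f ε) x‖ ≤ C * (ε : ℝ) ^ r

theorem uniformBigO_of_forall
    (h : ∀ i ≤ n, ∃ C : ℝ, ∀ ε : Eps, (ε : ℝ) < 1 → ∀ x,
      ‖iteratedFDeriv ℝ i (f ε) x‖ ≤ C * (ε : ℝ) ^ r) : UniformBigO f n r := by
  choose! C hC using h
  refine ⟨∑ i ∈ Finset.range (n + 1), |C i|, Finset.sum_nonneg fun _ _ => abs_nonneg _,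
    fun ε hε i hi x => (hC i hi ε hε x).trans ?_⟩
  have h0 : (0 : ℝ) < ε := ε.2.1
  refine mul_le_mul_of_nonneg_right ((le_abs_self _).trans ?_) (by positivity)
  exact Finset.single_le_sum (f := fun i => |C i|) (fun _ _ => abs_nonneg _)
    (Finset.mem_range.2 (Nat.lt_succ_of_le hi))

theorem UniformBigO.mono {s : ℤ} (h : UniformBigO f n r) (hrs : s ≤ r) : UniformBigO f n s := by
  obtain ⟨C, hC, H⟩ := h
  refine ⟨C, hC, fun ε hε i hi x => (H ε hε i hi x).trans ?_⟩
  exact mul_le_mul_of_nonneg_left (zpow_le_zpow_right_of_le_one₀ ε.2.1 ε.2.2 hrs) hC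

theorem UniformBigO.add (hf : ∀ ε, ContDiff ℝ ∞ (f ε)) (hg : ∀ ε, ContDiff ℝ ∞ (g ε))
    (h : UniformBigO f n r) (h' : UniformBigO g n r) : UniformBigO (f + g) n r := by
  obtain ⟨C, hC, H⟩ := h
  obtain ⟨C', hC', H'⟩ := h'
  refine ⟨C + C', by positivity, fun ε hε i hi x => ?_⟩
  have e : iteratedFDeriv ℝ i ((f + g) ε) x
      = iteratedFDeriv ℝ i (f ε) x + iteratedFDeriv ℝ i (g ε) x :=
    iteratedFDeriv_add_apply ((hf ε).contDiffAt.of_le (by exact_mod_cast le_top))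
      ((hg ε).contDiffAt.of_le (by exact_mod_cast le_top))
  rw [e, add_mul]
  exact (norm_add_le _ _).trans (add_le_add (H ε hε i hi x) (H' ε hε i hi x))

/-- Uniform bounds for `g_ε` yield bounds for the convolutions `(aT) * g_ε`. -/
theorem exists_seminormLittleO_conv {Ω : Opens (Space d)} (T : Distribution Ω ℂ ⊤)
    {a : Space d → ℝ} (ha : IsTest Ω a) :
    ∃ m : ℕ, ∀ (l : ℕ) (r : ℤ) (g : Net d), (∀ ε, ContDiff ℝ ∞ (g ε)) → UniformBigO g (m + l) r →
      ∀ K : Set (Space d), SeminormLittleO K l (fun ε => conv T a (g ε)) (r - 1) := by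
  obtain ⟨C, hC, m, H⟩ := exists_norm_iteratedFDeriv_conv_le T ha
  refine ⟨m, fun l r g hg ⟨B, hB, hgB⟩ K c hc => ?_⟩
  -- Giving up one power of `ε` turns the big-O bound into a little-o; the `1` ensures `ε < 1`, as
  -- `UniformBigO` requires.
  refine ⟨min 1 (c / (C * B + 1)), by positivity, fun ε hε i hi x _ => ?_⟩
  have h0 : (0 : ℝ) < ε := ε.2.1
  refine (H i (g ε) (hg ε) (B * (ε : ℝ) ^ r) (by positivity) (fun j hj z =>
    hgB ε (hε.trans_le (min_le_left _ _)) j (hj.trans (by omega)) z) x).trans ?_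
  have h1 := (hε.trans_le (min_le_right _ _)).le
  rw [le_div_iff₀ (by positivity)] at h1
  have h2 : (ε : ℝ) ^ r = ε * (ε : ℝ) ^ (r - 1) := by
    rw [zpow_sub_one₀ h0.ne']
    field_simp
  rw [h2, ← mul_assoc, ← mul_assoc]
  refine mul_le_mul_of_nonneg_right ?_ (by positivity)
  nlinarith

end Bounds

/-! ### Estimates for `ρ_ε`, `θ_ε` and their difference -/

section Mollifier

variable {d : ℕ} (ρ : SchwartzMap (Space d) ℂ) {χ : Space d → ℝ}

theorem contDiff_rhoNet (ε : Eps) : ContDiff ℝ ∞ (rhoNet ρ ε) :=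
  contDiff_const.mul ((ρ.smooth ⊤).comp (contDiff_const_smul _))

theorem IsCutoff.contDiff_scaled (hχ : IsCutoff χ) (L : ℝ) :
    ContDiff ℝ ∞ (fun x => (χ (L • x) : ℂ)) :=
  Complex.ofRealCLM.contDiff.comp (hχ.isTest.1.comp (contDiff_const_smul _))

theorem thetaNet_of_ne_one {ε : Eps} (hε : (ε : ℝ) ≠ 1) (x : Space d) :
    thetaNet ρ χ ε x = rhoNet ρ ε x * (χ (|Real.log ε| • x) : ℂ) := by
  simp [thetaNet, hε]

theorem contDiff_thetaNet (hχ : IsCutoff χ) (ε : Eps) : ContDiff ℝ ∞ (thetaNet ρ χ ε) := by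
  by_cases hε : (ε : ℝ) = 1
  · have : thetaNet ρ χ ε = fun _ => 1 := by
      funext x
      simp [thetaNet, hε]
    rw [this]
    exact contDiff_const
  · have : thetaNet ρ χ ε = fun x => rhoNet ρ ε x * (χ (|Real.log ε| • x) : ℂ) :=
      funext (thetaNet_of_ne_one ρ hε)
    rw [this]
    exact (contDiff_rhoNet ρ ε).mul (hχ.contDiff_scaled _)

theorem norm_iteratedFDeriv_rhoNet (ε : Eps) (i : ℕ) (x : Space d) :
    ‖iteratedFDeriv ℝ i (rhoNet ρ ε) x‖
      = (ε : ℝ)⁻¹ ^ (d + i) * ‖iteratedFDeriv ℝ i ρ ((ε : ℝ)⁻¹ • x)‖ := by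
  have h0 : (0 : ℝ) < ε := ε.2.1
  have h1 : rhoNet ρ ε = (1 / (ε : ℝ) ^ d) • fun x => ρ ((ε : ℝ)⁻¹ • x) := by
    funext x
    simp [rhoNet]
  have h2 : ContDiff ℝ i (fun x => ρ ((ε : ℝ)⁻¹ • x)) :=
    ((ρ.smooth ⊤).comp (contDiff_const_smul _)).of_le (by exact_mod_cast le_top)
  rw [h1, iteratedFDeriv_const_smul_apply h2.contDiffAt, iteratedFDeriv_comp_const_smul _
    ((ρ.smooth ⊤).of_le (by exact_mod_cast le_top)), norm_smul, norm_smul, norm_pow,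
    Real.norm_of_nonneg (by positivity), Real.norm_of_nonneg (by positivity), pow_add, ← mul_assoc]
  simp only [one_div, inv_pow]

theorem exists_norm_iteratedFDeriv_rhoNet_le (i : ℕ) :
    ∃ C : ℝ, 0 ≤ C ∧ ∀ (ε : Eps) (x : Space d),
      ‖iteratedFDeriv ℝ i (rhoNet ρ ε) x‖ ≤ C * (ε : ℝ)⁻¹ ^ (d + i) := by
  refine ⟨SchwartzMap.seminorm ℝ 0 i ρ, apply_nonneg _ _, fun ε x => ?_⟩
  have h0 : (0 : ℝ) < ε := ε.2.1
  rw [norm_iteratedFDeriv_rhoNet, mul_comm]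
  refine mul_le_mul_of_nonneg_right ?_ (by positivity)
  exact SchwartzMap.norm_iteratedFDeriv_le_seminorm ℝ ρ i _

/-- This is the square of `|√ε ln ε| ≤ 2`. -/
theorem mul_sq_log_le (ε : Eps) : (ε : ℝ) * |Real.log ε| ^ 2 ≤ 4 := by
  have h0 : (0 : ℝ) < ε := ε.2.1
  have h := (Real.abs_log_mul_self_rpow_lt ε (1 / 2) h0 ε.2.2 (by norm_num)).le
  rw [← Real.sqrt_eq_rpow, abs_mul, abs_of_nonneg (Real.sqrt_nonneg _)] at h
  have h2 := pow_le_pow_left₀ (by positivity) h 2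
  rw [mul_pow, Real.sq_sqrt h0.le] at h2
  linarith

theorem abs_log_le_inv (ε : Eps) : |Real.log ε| ≤ (ε : ℝ)⁻¹ := by
  have h0 : (0 : ℝ) < ε := ε.2.1
  rw [abs_of_nonpos (Real.log_nonpos h0.le ε.2.2), ← Real.log_inv]
  have := Real.log_le_sub_one_of_pos (inv_pos.2 h0)
  linarith

/-- Away from the ball of radius `1 / |ln ε|` the derivatives of `ρ_ε` are rapidly decreasing
in `ε`. -/
theorem exists_norm_iteratedFDeriv_rhoNet_far_le (i p : ℕ) :
    ∃ C : ℝ, 0 ≤ C ∧ ∀ (ε : Eps) (x : Space d), 1 ≤ |Real.log ε| * ‖x‖ →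
      ‖iteratedFDeriv ℝ i (rhoNet ρ ε) x‖ ≤ C * (ε : ℝ) ^ p := by
  -- Of the `N` powers of `ε` gained from decay, `d + i` cancel the scaling factor of the `i`-th
  -- derivative of `ρ_ε`, and `p` remain.
  set N := p + (d + i) with hN
  refine ⟨4 ^ N * SchwartzMap.seminorm ℝ (2 * N) i ρ, by positivity, fun ε x hx => ?_⟩
  have h0 : (0 : ℝ) < ε := ε.2.1
  set z := (ε : ℝ)⁻¹ • x with hz
  have hxz : ‖x‖ = ε * ‖z‖ := by
    rw [hz, norm_smul, norm_inv, Real.norm_of_nonneg h0.le]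
    field_simp
  -- A quantity at least `1` that carries a factor `ε`: its `N`-th power can be inserted for free,
  -- and Schwartz decay absorbs `‖z‖ ^ (2 * N)`.
  have h1 : 1 ≤ 4 * ε * ‖z‖ ^ 2 := by
    calc (1 : ℝ) ≤ (|Real.log ε| * ‖x‖) ^ 2 := one_le_pow₀ hx
      _ = (ε * |Real.log ε| ^ 2) * (ε * ‖z‖ ^ 2) := by
        rw [hxz]
        ring
      _ ≤ 4 * (ε * ‖z‖ ^ 2) :=
        mul_le_mul_of_nonneg_right (mul_sq_log_le ε) (by positivity)
      _ = 4 * ε * ‖z‖ ^ 2 := by ring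
  rw [norm_iteratedFDeriv_rhoNet]
  calc (ε : ℝ)⁻¹ ^ (d + i) * ‖iteratedFDeriv ℝ i ρ z‖
      ≤ (ε : ℝ)⁻¹ ^ (d + i) * ((4 * ε * ‖z‖ ^ 2) ^ N * ‖iteratedFDeriv ℝ i ρ z‖) := by
        refine mul_le_mul_of_nonneg_left ?_ (by positivity)
        exact le_mul_of_one_le_left (norm_nonneg _) (one_le_pow₀ h1)
    _ = (ε : ℝ)⁻¹ ^ (d + i) * (ε : ℝ) ^ N *
          (4 ^ N * (‖z‖ ^ (2 * N) * ‖iteratedFDeriv ℝ i ρ z‖)) := by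
        rw [mul_pow, mul_pow, ← pow_mul]
        ring
    _ = (ε : ℝ) ^ p * (4 ^ N * (‖z‖ ^ (2 * N) * ‖iteratedFDeriv ℝ i ρ z‖)) := by
        congr 1
        rw [hN, pow_add _ p, mul_left_comm, ← mul_pow, inv_mul_cancel₀ h0.ne', one_pow, mul_one]
    _ ≤ (ε : ℝ) ^ p * (4 ^ N * SchwartzMap.seminorm ℝ (2 * N) i ρ) := by
        refine mul_le_mul_of_nonneg_left (mul_le_mul_of_nonneg_left ?_ (by positivity))
          (by positivity)
        exact SchwartzMap.le_seminorm ℝ (2 * N) i ρ z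
    _ = _ := mul_comm _ _

theorem IsCutoff.exists_norm_iteratedFDeriv_le (hχ : IsCutoff χ) (i : ℕ) :
    ∃ C : ℝ, 0 ≤ C ∧ ∀ (ε : Eps) (x : Space d),
      ‖iteratedFDeriv ℝ i (fun x => (χ (|Real.log ε| • x) : ℂ)) x‖ ≤ C * (ε : ℝ)⁻¹ ^ i := by
  have hc : ContDiff ℝ ∞ (fun x => (χ x : ℂ)) := Complex.ofRealCLM.contDiff.comp hχ.isTest.1
  have hs : HasCompactSupport (fun x => (χ x : ℂ)) :=
    hχ.isTest.2.1.comp_left (g := ((↑) : ℝ → ℂ)) Complex.ofReal_zero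
  obtain ⟨C, hC⟩ := (hs.iteratedFDeriv (𝕜 := ℝ) i).exists_bound_of_continuous
    (hc.continuous_iteratedFDeriv (m := i) (by exact_mod_cast le_top))
  have hC0 : 0 ≤ C := (norm_nonneg _).trans (hC 0)
  refine ⟨C, hC0, fun ε x => ?_⟩
  rw [iteratedFDeriv_comp_const_smul (f := fun x => (χ x : ℂ)) _
    (hc.of_le (by exact_mod_cast le_top)), norm_smul, norm_pow, Real.norm_eq_abs, abs_abs, mul_comm]
  exact mul_le_mul (hC _) (pow_le_pow_left₀ (abs_nonneg _) (abs_log_le_inv ε) i)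
    (by positivity) hC0

theorem uniformBigO_rhoNet (n : ℕ) : UniformBigO (rhoNet ρ) n (-((d + n : ℕ) : ℤ)) := by
  refine uniformBigO_of_forall fun i hi => ?_
  obtain ⟨C, hC, H⟩ := exists_norm_iteratedFDeriv_rhoNet_le ρ i
  refine ⟨C, fun ε _ x => (H ε x).trans ?_⟩
  rw [zpow_neg, zpow_natCast, ← inv_pow]
  refine mul_le_mul_of_nonneg_left ?_ hC
  exact pow_le_pow_right₀ (one_le_inv_iff₀.2 ε.2) (by omega)

/-- The cut off `θ_ε` differs from `ρ_ε` by a function all of whose derivatives are uniformly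
rapidly decreasing in `ε`. -/
theorem uniformBigO_thetaNet_sub_rhoNet (hχ : IsCutoff χ) (n p : ℕ) :
    UniformBigO (thetaNet ρ χ - rhoNet ρ) n (p : ℤ) := by
  refine uniformBigO_of_forall fun i _ => ?_
  -- The extra `i` powers pay for the derivatives of the scaled cutoff, which may grow like `ε ^
  -- (-i)`.
  choose C hC H using fun j => exists_norm_iteratedFDeriv_rhoNet_far_le ρ j (p + i)
  choose A hA HA using fun j => hχ.exists_norm_iteratedFDeriv_le j
  refine ⟨(∑ j ∈ Finset.range (i + 1), (i.choose j : ℝ) * C j * A (i - j)) + C i,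
    fun ε hε x => ?_⟩
  have h0 : (0 : ℝ) < ε := ε.2.1
  set L := |Real.log ε| with hL
  have e : (thetaNet ρ χ - rhoNet ρ) ε = fun x => rhoNet ρ ε x * (χ (L • x) : ℂ) - rhoNet ρ ε x :=
    funext fun x => by
      rw [Pi.sub_apply, Pi.sub_apply, thetaNet_of_ne_one ρ hε.ne]
  have hpos : 0 ≤ ∑ j ∈ Finset.range (i + 1), (i.choose j : ℝ) * C j * A (i - j) :=
    Finset.sum_nonneg fun j _ => mul_nonneg (mul_nonneg (by positivity) (hC j)) (hA _)
  rw [e, zpow_natCast]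
  -- In the inner region, which is open, the cutoff is `1`, so the difference and all its
  -- derivatives vanish; outside, the decay of `ρ` applies.
  rcases lt_or_ge (L * ‖x‖) 1 with hx | hx
  · have hz : (fun x => rhoNet ρ ε x * (χ (L • x) : ℂ) - rhoNet ρ ε x) =ᶠ[𝓝 x] fun _ => 0 := by
      have hopen : IsOpen {x : Space d | L * ‖x‖ < 1} :=
        isOpen_lt (continuous_const.mul continuous_norm) continuous_const
      filter_upwards [hopen.mem_nhds hx] with y hy
      rw [hχ.eq_one (L • y), Complex.ofReal_one, mul_one, sub_self]
      rw [mem_closedBall_zero_iff, norm_smul, hL, Real.norm_eq_abs, abs_abs, ← hL]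
      exact le_of_lt hy
    rw [(hz.iteratedFDeriv ℝ i).eq_of_nhds, iteratedFDeriv_fun_zero]
    simp only [Pi.zero_apply, norm_zero]
    have := hC i
    positivity
  · have hρ := contDiff_rhoNet ρ ε
    have hχ' := hχ.contDiff_scaled L
    have hi : ((i : ℕ) : ℕ∞ω) ≤ ∞ := by exact_mod_cast le_top
    have hs : iteratedFDeriv ℝ i (fun x => rhoNet ρ ε x * (χ (L • x) : ℂ) - rhoNet ρ ε x) x
        = iteratedFDeriv ℝ i (fun x => rhoNet ρ ε x * (χ (L • x) : ℂ)) x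
          - iteratedFDeriv ℝ i (rhoNet ρ ε) x :=
      iteratedFDeriv_sub_apply ((hρ.mul hχ').of_le hi).contDiffAt (hρ.of_le hi).contDiffAt
    rw [hs, add_mul]
    refine (norm_sub_le _ _).trans (add_le_add ?_ ?_)
    · refine (norm_iteratedFDeriv_mul_le hρ hχ' x hi).trans ?_
      rw [Finset.sum_mul]
      refine Finset.sum_le_sum fun j _ => ?_
      have h1 := H j ε x hx
      have h2 := HA (i - j) ε x
      have h3 : (ε : ℝ)⁻¹ ^ (i - j) ≤ (ε : ℝ)⁻¹ ^ i :=
        pow_le_pow_right₀ (one_le_inv_iff₀.2 ε.2) (Nat.sub_le _ _)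
      calc _ ≤ (i.choose j : ℝ) * (C j * (ε : ℝ) ^ (p + i)) * (A (i - j) * (ε : ℝ)⁻¹ ^ i) := by
            refine mul_le_mul (mul_le_mul_of_nonneg_left h1 (by positivity))
              (h2.trans (mul_le_mul_of_nonneg_left h3 (hA _))) (norm_nonneg _) ?_
            have := hC j
            positivity
        _ = (i.choose j : ℝ) * C j * A (i - j) * (ε : ℝ) ^ p * ((ε : ℝ) ^ i * (ε : ℝ)⁻¹ ^ i) := by
            ring
        _ = _ := by
            rw [← mul_pow, mul_inv_cancel₀ h0.ne', one_pow, mul_one]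
    · refine (H i ε x hx).trans (mul_le_mul_of_nonneg_left ?_ (hC i))
      exact pow_le_pow_of_le_one h0.le ε.2.2 (by omega)

theorem uniformBigO_thetaNet (hχ : IsCutoff χ) (n : ℕ) :
    UniformBigO (thetaNet ρ χ) n (-((d + n : ℕ) : ℤ)) := by
  have h : UniformBigO (thetaNet ρ χ - rhoNet ρ + rhoNet ρ) n (-((d + n : ℕ) : ℤ)) :=
    UniformBigO.add (fun ε => (contDiff_thetaNet ρ hχ ε).sub (contDiff_rhoNet ρ ε))
    (contDiff_rhoNet ρ) ((uniformBigO_thetaNet_sub_rhoNet ρ hχ n 0).mono (by simp))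
    (uniformBigO_rhoNet ρ n)
  rwa [sub_add_cancel] at h

end Mollifier

/-! ### Locality of moderateness and negligibility; nets of convolutions -/

section Local

variable {d : ℕ} {Ω : Opens (Space d)} {f g : Net d} {K K' : Set (Space d)} {l : ℕ} {r : ℤ}

/-- Equality on an open set carries over to all derivatives, and only small `ε` matter for the
asymptotics. -/
theorem SeminormLittleO.congr {W : Set (Space d)} (hW : IsOpen W) (hK : K ⊆ W)
    (h : ∃ η : ℝ, 0 < η ∧ ∀ ε : Eps, (ε : ℝ) < η → EqOn (f ε) (g ε) W)
    (hf : SeminormLittleO K l f r) : SeminormLittleO K l g r := by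
  obtain ⟨η, hη, H⟩ := h
  intro c hc
  obtain ⟨η', hη', H'⟩ := hf c hc
  refine ⟨min η η', lt_min hη hη', fun ε hε i hi x hx => ?_⟩
  have e : f ε =ᶠ[𝓝 x] g ε :=
    (H ε (hε.trans_le (min_le_left _ _))).eventuallyEq_of_mem (hW.mem_nhds (hK hx))
  rw [← (e.iteratedFDeriv ℝ i).eq_of_nhds]
  exact H' ε (hε.trans_le (min_le_right _ _)) i hi x hx

theorem SeminormLittleO.union (h : SeminormLittleO K l f r) (h' : SeminormLittleO K' l f r) :
    SeminormLittleO (K ∪ K') l f r := by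
  intro c hc
  obtain ⟨η, hη, H⟩ := h c hc
  obtain ⟨η', hη', H'⟩ := h' c hc
  refine ⟨min η η', lt_min hη hη', fun ε hε i hi x hx => ?_⟩
  rcases hx with hx | hx
  · exact H ε (hε.trans_le (min_le_left _ _)) i hi x hx
  · exact H' ε (hε.trans_le (min_le_right _ _)) i hi x hx

theorem SeminormLittleO.mono_set (hK : K ⊆ K') (h : SeminormLittleO K' l f r) :
    SeminormLittleO K l f r := by
  intro c hc
  obtain ⟨η, hη, H⟩ := h c hc
  exact ⟨η, hη, fun ε hε i hi x hx => H ε hε i hi x (hK hx)⟩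

theorem SeminormLittleO.empty : SeminormLittleO ∅ l f r :=
  fun _ _ => ⟨1, one_pos, fun _ _ _ _ _ hx => hx.elim⟩

section Cover

variable {L : Type*} {U : L → Opens (Space d)}

theorem contDiffOn_of_cover {F : Space d → ℂ} (hU : ∀ x ∈ Ω, ∃ l, x ∈ U l)
    (h : ∀ l, ContDiffOn ℝ ∞ F (U l : Set (Space d))) : ContDiffOn ℝ ∞ F (Ω : Set (Space d)) := by
  intro x hx
  obtain ⟨l, hl⟩ := hU x hx
  exact ((h l).contDiffAt ((U l).isOpen.mem_nhds hl)).contDiffWithinAt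

theorem exists_compact_nhdsWithin_of_cover (hU : ∀ x ∈ Ω, ∃ l, x ∈ U l) (hK : K ⊆ Ω)
    {x : Space d} (hx : x ∈ K) : ∃ l, ∃ N ∈ 𝓝[K] x, IsCompact N ∧ N ⊆ U l := by
  obtain ⟨l, hl⟩ := hU x (hK hx)
  obtain ⟨N, hN, hNU, hNc⟩ := local_compact_nhds ((U l).isOpen.mem_nhds hl)
  exact ⟨l, N, mem_nhdsWithin_of_mem_nhds hN, hNc, hNU⟩

/-- Moderateness is a local property. -/
theorem isModerate_of_cover (hU : ∀ x ∈ Ω, ∃ l, x ∈ U l) (h : ∀ l, IsModerate (U l) f) :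
    IsModerate Ω f := by
  refine ⟨fun ε => contDiffOn_of_cover hU fun l => (h l).1 ε, fun n K hK hKΩ => ?_⟩
  -- Compactness reduces `K` to finitely many compact pieces, each inside one `U l`; the maximum of
  -- their exponents serves `K`.
  refine hK.induction_on (p := fun K => ∃ q : ℕ, SeminormLittleO K n f (-(q : ℤ)))
    ⟨0, .empty⟩ (fun s t hst ⟨q, hq⟩ => ⟨q, hq.mono_set hst⟩) ?_ fun x hx => ?_
  · rintro s t ⟨q, hq⟩ ⟨q', hq'⟩
    exact ⟨max q q', (hq.mono (by simp)).union (hq'.mono (by simp))⟩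
  · obtain ⟨l, N, hN, hNc, hNU⟩ := exists_compact_nhdsWithin_of_cover hU hKΩ hx
    exact ⟨N, hN, (h l).2 n N hNc hNU⟩

/-- Negligibility is a local property. -/
theorem isNegligible_of_cover (hU : ∀ x ∈ Ω, ∃ l, x ∈ U l) (h : ∀ l, IsNegligible (U l) f) :
    IsNegligible Ω f := by
  refine ⟨fun ε => contDiffOn_of_cover hU fun l => (h l).1 ε, fun n K hK hKΩ p => ?_⟩
  refine hK.induction_on (p := fun K => SeminormLittleO K n f (p : ℤ))
    .empty (fun s t hst hq => hq.mono_set hst) (fun s t hs ht => hs.union ht) fun x hx => ?_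
  obtain ⟨l, N, hN, hNc, hNU⟩ := exists_compact_nhdsWithin_of_cover hU hKΩ hx
  exact ⟨N, hN, (h l).2 n N hNc hNU p⟩

end Cover

theorem IsModerate.congr (hf : IsModerate Ω f)
    (hg : ∀ ε, ContDiffOn ℝ ∞ (g ε) (Ω : Set (Space d)))
    (h : ∃ η : ℝ, 0 < η ∧ ∀ ε : Eps, (ε : ℝ) < η → EqOn (f ε) (g ε) Ω) : IsModerate Ω g :=
  ⟨hg, fun l K hK hKΩ =>
    let ⟨q, hq⟩ := hf.2 l K hK hKΩ
    ⟨q, hq.congr Ω.isOpen hKΩ h⟩⟩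

theorem IsNegligible.congr (hf : IsNegligible Ω f)
    (hg : ∀ ε, ContDiffOn ℝ ∞ (g ε) (Ω : Set (Space d)))
    (h : ∃ η : ℝ, 0 < η ∧ ∀ ε : Eps, (ε : ℝ) < η → EqOn (f ε) (g ε) Ω) : IsNegligible Ω g :=
  ⟨hg, fun l K hK hKΩ p => (hf.2 l K hK hKΩ p).congr Ω.isOpen hKΩ h⟩

variable {Ω' : Opens (Space d)} (T : Distribution Ω ℂ ⊤) {a : Space d → ℝ}

theorem isModerate_conv (ha : IsTest Ω a) (hg : ∀ ε, ContDiff ℝ ∞ (g ε))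
    (h : ∀ n, UniformBigO g n (-((d + n : ℕ) : ℤ))) :
    IsModerate Ω' (fun ε => conv T a (g ε)) := by
  refine ⟨fun ε => (contDiff_conv T ha (hg ε)).contDiffOn, fun l K _ _ => ?_⟩
  obtain ⟨m, H⟩ := exists_seminormLittleO_conv T ha
  refine ⟨d + (m + l) + 1, ?_⟩
  have h1 := H l _ g hg (h (m + l)) K
  refine h1.mono ?_
  push_cast
  linarith

theorem isNegligible_conv (ha : IsTest Ω a) (hg : ∀ ε, ContDiff ℝ ∞ (g ε))
    (h : ∀ n p : ℕ, UniformBigO g n (p : ℤ)) :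
    IsNegligible Ω' (fun ε => conv T a (g ε)) := by
  refine ⟨fun ε => (contDiff_conv T ha (hg ε)).contDiffOn, fun l K _ _ p => ?_⟩
  obtain ⟨m, H⟩ := exists_seminormLittleO_conv T ha
  refine (H l _ g hg (h (m + l) (p + 1)) K).mono ?_
  push_cast
  linarith

end Local

/-! ### Cutoffs become invisible to `θ_ε` -/

section Plateau

variable {d : ℕ} {Ω : Opens (Space d)} {K : Set (Space d)}

/-- For small `ε` the functions `a_ε` are equal to `1` on a fixed neighbourhood of `K`. -/
def EventuallyOneNear (a : Eps → Space d → ℝ) (K : Set (Space d)) : Prop :=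
  ∃ r : ℝ, 0 < r ∧ ∃ η : ℝ, 0 < η ∧ ∀ ε : Eps, (ε : ℝ) < η → ∀ y ∈ K, ∀ x, dist x y ≤ r → a ε x = 1

theorem exists_mem_exhaustion (hK : IsCompact K) (hKΩ : K ⊆ Ω) :
    ∃ r : ℝ, 0 < r ∧ ∃ η : ℝ, 0 < η ∧ ∀ ε : Eps, (ε : ℝ) < η → ∀ y ∈ K, ∀ x, dist x y ≤ r →
      x ∈ exhaustion Ω ε := by
  obtain ⟨δ, hδ, hδΩ⟩ := hK.exists_cthickening_subset_open Ω.isOpen hKΩ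
  obtain ⟨R, hR0, hR⟩ := hK.isBounded.exists_pos_norm_le
  -- The `δ`-thickening of `K` lies in `Ω`, so points within `δ / 2` of `K` are at least `δ / 2`
  -- away from the complement; their norm is at most `R + δ`.
  refine ⟨δ / 2, by positivity, min (δ / 2) (1 / (R + δ)), by positivity,
    fun ε hε y hy x hxy => ⟨?_, ?_, ?_⟩⟩
  · exact hδΩ (Metric.mem_cthickening_of_dist_le x y δ K hy (hxy.trans (by linarith)))
  · rw [Metric.le_infEDist]
    intro z hz
    rw [edist_dist]
    refine ENNReal.ofReal_le_ofReal ?_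
    by_contra! hlt
    have h1 := hε.trans_le (min_le_left _ _)
    refine hz (hδΩ (Metric.mem_cthickening_of_dist_le z y δ K hy ?_))
    have := dist_triangle z x y
    rw [dist_comm z x] at this
    linarith
  · have h0 : (0 : ℝ) < ε := ε.2.1
    have h1 := (hε.trans_le (min_le_right _ _)).le
    rw [le_div_iff₀ (by positivity)] at h1
    rw [le_div_iff₀ h0]
    have h2 := dist_triangle x y 0
    have h3 := hR y hy
    rw [dist_zero_right y] at h2
    nlinarith

theorem IsCutoffNet.eventuallyOneNear {κ : Eps → Space d → ℝ} (hκ : IsCutoffNet Ω κ)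
    (hK : IsCompact K) (hKΩ : K ⊆ Ω) : EventuallyOneNear κ K := by
  obtain ⟨r, hr, η, hη, H⟩ := exists_mem_exhaustion hK hKΩ
  exact ⟨r, hr, η, hη, fun ε hε y hy x hx => hκ.eq_one ε x (H ε hε y hy x hx)⟩

theorem IsPlateau.eventuallyOneNear {L : Type*} {U : L → Opens (Space d)} {ψ : L → Space d → ℝ}
    (hU : IsCovering Ω U) (hψ : IsPlateau Ω U ψ) (l : L) :
    EventuallyOneNear (fun _ => ψ l) (closure (U l : Set (Space d))) := by
  obtain ⟨δ, hδ, H⟩ := (Metric.hasBasis_nhdsSet_cthickening (hU.isCompact_closure l)).eventually_iff.1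
    (hψ.eq_one l)
  exact ⟨δ, hδ, 1, one_pos, fun ε _ y hy x hx => H (Metric.mem_cthickening_of_dist_le x y δ _ hy hx)⟩

/-- The condition on `ε` says that the support radius `2 / |ln ε|` is less than `r`. -/
theorem thetaNet_eq_zero (ρ : SchwartzMap (Space d) ℂ) {χ : Space d → ℝ} (hχ : IsCutoff χ) {r : ℝ}
    (hr : 0 < r) {ε : Eps} (hε : (ε : ℝ) < Real.exp (-(2 / r))) {z : Space d} (hz : r < ‖z‖) :
    thetaNet ρ χ ε z = 0 := by
  have h0 : (0 : ℝ) < ε := ε.2.1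
  have h1 := (Real.log_lt_iff_lt_exp h0).2 hε
  have h2 : (0 : ℝ) < 2 / r := by positivity
  have hne : (ε : ℝ) ≠ 1 := by
    rintro h
    rw [h, Real.log_one] at h1
    linarith
  rw [thetaNet_of_ne_one ρ hne, hχ.eq_zero, Complex.ofReal_zero, mul_zero]
  rw [mem_ball_zero_iff, norm_smul, Real.norm_eq_abs, abs_abs, not_lt]
  have h3 : 2 / r ≤ |Real.log ε| := by
    rw [abs_of_neg (by linarith)]
    linarith
  calc (2 : ℝ) = 2 / r * r := by field_simp
    _ ≤ |Real.log ε| * ‖z‖ := mul_le_mul h3 hz.le hr.le (abs_nonneg _)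

/-- For small `ε` the support of `θ_ε(y - ·)` lies where `a_ε = 1`. This makes different cutoffs
interchangeable, and removable altogether. -/
theorem EventuallyOneNear.mul_thetaNet (ρ : SchwartzMap (Space d) ℂ) {χ : Space d → ℝ}
    (hχ : IsCutoff χ) {a : Eps → Space d → ℝ} (ha : EventuallyOneNear a K) :
    ∃ η : ℝ, 0 < η ∧ ∀ ε : Eps, (ε : ℝ) < η → ∀ y ∈ K, ∀ x,
      (a ε x : ℂ) * thetaNet ρ χ ε (y - x) = thetaNet ρ χ ε (y - x) := by
  obtain ⟨r, hr, η, hη, H⟩ := ha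
  refine ⟨min η (Real.exp (-(2 / r))), lt_min hη (Real.exp_pos _), fun ε hε y hy x => ?_⟩
  rcases le_or_gt (dist x y) r with hx | hx
  · rw [H ε (hε.trans_le (min_le_left _ _)) y hy x hx, Complex.ofReal_one, one_mul]
  · rw [thetaNet_eq_zero ρ hχ hr (hε.trans_le (min_le_right _ _)), mul_zero]
    rwa [dist_comm, dist_eq_norm] at hx

end Plateau

/-! ### Comparison of the three nets and the common embedding -/

section Main

variable {d : ℕ} {Ω : Opens (Space d)} {ρ : SchwartzMap (Space d) ℂ} {χ : Space d → ℝ}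
  {κ : Eps → Space d → ℝ}

/-- A distribution acting on the translates `g(y - ·)` of a function is smooth in `y` as long as
these translates are test functions. -/
theorem contDiffOn_pairing_comp_sub (T : Distribution Ω ℂ ⊤) (hκ : IsCutoffNet Ω κ)
    {V : Opens (Space d)} {g : Space d → ℂ} (hg : ContDiff ℝ ∞ g)
    (h : ∀ y ∈ V, IsTest Ω (fun x => g (y - x))) :
    ContDiffOn ℝ ∞ (fun y => pairing T (fun x => g (y - x))) (V : Set (Space d)) := by
  intro y hy
  refine ContDiffAt.contDiffWithinAt ?_
  obtain ⟨r, hr, η, hη, H⟩ := hκ.eventuallyOneNear (h y hy).2.1 (h y hy).2.2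
  -- The net `κ` only supplies one fixed test function that is `1` near the support of `g(y - ·)`;
  -- near `y` the pairing is then a convolution, which is smooth.
  let ε : Eps := ⟨min (η / 2) 1, lt_min (by positivity) one_pos, min_le_right _ _⟩
  have hε : (ε : ℝ) < η := (min_le_left _ _).trans_lt (by linarith)
  refine (contDiff_conv T (hκ.isTest ε) hg).contDiffAt.congr_of_eventuallyEq ?_
  filter_upwards [Metric.closedBall_mem_nhds y hr] with y' hy'
  unfold conv
  congr 1
  funext x
  by_cases hx : g (y' - x) = 0
  · rw [hx, mul_zero]
  -- The support of `g(y' - ·)` is that of `g(y - ·)` shifted by `y' - y`, hence stays within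
  -- distance `r`.
  · have hx' : x + (y - y') ∈ tsupport (fun x => g (y - x)) := by
      refine subset_tsupport _ ?_
      rw [Function.mem_support]
      convert hx using 2
      abel
    rw [H ε hε _ hx' x, Complex.ofReal_one, one_mul]
    rw [dist_eq_norm, sub_add_cancel_left, neg_sub, ← dist_eq_norm]
    exact hy'

theorem contDiffOn_localNet (hχ : IsCutoff χ) (hκ : IsCutoffNet Ω κ) {M : Type*}
    {V : M → Opens (Space d)} {e : M → Eps} (he : IsThreshold Ω (thetaNet ρ χ) V e)
    (T : Distribution Ω ℂ ⊤) (μ : M) (ε : Eps) :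
    ContDiffOn ℝ ∞ (localNet (thetaNet ρ χ) (e μ) T ε) (V μ : Set (Space d)) :=
  contDiffOn_pairing_comp_sub T hκ (contDiff_thetaNet ρ hχ _)
    fun y hy => he μ _ (min_le_right ε (e μ).sq) y hy

theorem contDiff_cutConv_thetaNet (hχ : IsCutoff χ) (hκ : IsCutoffNet Ω κ)
    (T : Distribution Ω ℂ ⊤) (ε : Eps) : ContDiff ℝ ∞ (cutConv κ (thetaNet ρ χ) T ε) :=
  contDiff_conv T (hκ.isTest ε) (contDiff_thetaNet ρ hχ ε)

variable {L : Type*} {U : L → Opens (Space d)} {ψ : L → Space d → ℝ}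

theorem exists_eqOn_cutConv (hχ : IsCutoff χ) (hκ : IsCutoffNet Ω κ) (hU : IsCovering Ω U)
    (hψ : IsPlateau Ω U ψ) (T : Distribution Ω ℂ ⊤) (l : L) :
    ∃ η : ℝ, 0 < η ∧ ∀ ε : Eps, (ε : ℝ) < η →
      EqOn (conv T (ψ l) (thetaNet ρ χ ε)) (cutConv κ (thetaNet ρ χ) T ε) (U l) := by
  obtain ⟨η, hη, H⟩ := (hκ.eventuallyOneNear (hU.isCompact_closure l)
    (hU.closure_subset l)).mul_thetaNet ρ hχ
  obtain ⟨η', hη', H'⟩ := (hψ.eventuallyOneNear hU l).mul_thetaNet ρ hχ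
  refine ⟨min η η', lt_min hη hη', fun ε hε y hy => ?_⟩
  have hy' := subset_closure hy
  change pairing T _ = pairing T _
  congr 1
  funext x
  rw [H ε (hε.trans_le (min_le_left _ _)) y hy' x, H' ε (hε.trans_le (min_le_right _ _)) y hy' x]

theorem isModerate_cutConv_rhoNet (hψ : IsPlateau Ω U ψ) (T : Distribution Ω ℂ ⊤) (l : L) :
    IsModerate (U l) (cutConv (fun _ => ψ l) (rhoNet ρ) T) :=
  isModerate_conv T (hψ.isTest l) (contDiff_rhoNet ρ) (uniformBigO_rhoNet ρ)

/-- The derivatives of `κ_ε` are not controlled as `ε → 0`, so on each `U l` the fixed cutoff `ψ l`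
takes over. -/
theorem isModerate_cutConv_thetaNet (hχ : IsCutoff χ) (hκ : IsCutoffNet Ω κ)
    (hU : IsCovering Ω U) (hψ : IsPlateau Ω U ψ) (T : Distribution Ω ℂ ⊤) :
    IsModerate Ω (cutConv κ (thetaNet ρ χ) T) :=
  isModerate_of_cover hU.covers fun l =>
    (isModerate_conv T (hψ.isTest l) (contDiff_thetaNet ρ hχ) (uniformBigO_thetaNet ρ hχ)).congr
      (fun ε => (contDiff_cutConv_thetaNet hχ hκ T ε).contDiffOn)
      (exists_eqOn_cutConv hχ hκ hU hψ T l)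

/-- Trading `κ_ε` for `ψ l` on `U l` leaves `(ψ_l T) * (θ_ε - ρ_ε)` for small `ε`. -/
theorem isNegligible_cutConv_sub (hχ : IsCutoff χ) (hκ : IsCutoffNet Ω κ)
    (hU : IsCovering Ω U) (hψ : IsPlateau Ω U ψ) (T : Distribution Ω ℂ ⊤) (l : L) :
    IsNegligible (U l)
      (cutConv κ (thetaNet ρ χ) T - cutConv (fun _ => ψ l) (rhoNet ρ) T) := by
  have h := isNegligible_conv (Ω' := U l) T (hψ.isTest l)
    (g := thetaNet ρ χ - rhoNet ρ)
    (fun ε => (contDiff_thetaNet ρ hχ ε).sub (contDiff_rhoNet ρ ε))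
    (uniformBigO_thetaNet_sub_rhoNet ρ hχ)
  refine h.congr (fun ε => ((contDiff_cutConv_thetaNet hχ hκ T ε).sub
    (contDiff_conv T (hψ.isTest l) (contDiff_rhoNet ρ ε))).contDiffOn) ?_
  obtain ⟨η, hη, H⟩ := exists_eqOn_cutConv hχ hκ hU hψ T l (ρ := ρ)
  refine ⟨η, hη, fun ε hε y hy => ?_⟩
  have h1 := conv_sub T (hψ.isTest l) (contDiff_thetaNet ρ hχ ε) (contDiff_rhoNet ρ ε) y
  rw [H ε hε hy] at h1
  exact h1

theorem exists_eqOn_localNet (hχ : IsCutoff χ) (hκ : IsCutoffNet Ω κ) {M : Type*}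
    {V : M → Opens (Space d)} (hV : IsCovering Ω V) (e : M → Eps) (T : Distribution Ω ℂ ⊤) (μ : M) :
    ∃ η : ℝ, 0 < η ∧ ∀ ε : Eps, (ε : ℝ) < η →
      EqOn (cutConv κ (thetaNet ρ χ) T ε) (localNet (thetaNet ρ χ) (e μ) T ε) (V μ) := by
  obtain ⟨η, hη, H⟩ := (hκ.eventuallyOneNear (hV.isCompact_closure μ)
    (hV.closure_subset μ)).mul_thetaNet ρ hχ
  -- Below `(e μ).sq` the frozen part of `localNet` plays no role.
  refine ⟨min η (e μ).sq, lt_min hη (e μ).sq.2.1, fun ε hε y hy => ?_⟩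
  have hmin : min ε (e μ).sq = ε := min_eq_left (hε.trans_le (min_le_right _ _)).le
  change pairing T _ = pairing T _
  rw [hmin]
  congr 1
  funext x
  exact H ε (hε.trans_le (min_le_left _ _)) y (subset_closure hy) x

theorem isModerate_localNet (hχ : IsCutoff χ) (hκ : IsCutoffNet Ω κ) {M : Type*}
    {V : M → Opens (Space d)} (hV : IsCovering Ω V) {e : M → Eps}
    (he : IsThreshold Ω (thetaNet ρ χ) V e) {T : Distribution Ω ℂ ⊤}
    (hT : IsModerate Ω (cutConv κ (thetaNet ρ χ) T)) (μ : M) :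
    IsModerate (V μ) (localNet (thetaNet ρ χ) (e μ) T) :=
  (hT.restrict (hV.le μ)).congr (contDiffOn_localNet hχ hκ he T μ)
    (exists_eqOn_localNet hχ hκ hV e T μ)

theorem isNegligible_cutConv_sub_localNet (hχ : IsCutoff χ) (hκ : IsCutoffNet Ω κ) {M : Type*}
    {V : M → Opens (Space d)} (hV : IsCovering Ω V) {e : M → Eps}
    (he : IsThreshold Ω (thetaNet ρ χ) V e) (T : Distribution Ω ℂ ⊤) (μ : M) :
    IsNegligible (V μ) (cutConv κ (thetaNet ρ χ) T - localNet (thetaNet ρ χ) (e μ) T) := by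
  refine IsNegligible.zero.congr (fun ε => (contDiff_cutConv_thetaNet hχ hκ T ε).contDiffOn.sub
    (contDiffOn_localNet hχ hκ he T μ ε)) ?_
  obtain ⟨η, hη, H⟩ := exists_eqOn_localNet hχ hκ hV e T μ (ρ := ρ)
  exact ⟨η, hη, fun ε hε y hy => (sub_eq_zero.2 (H ε hε hy)).symm⟩

theorem cls_eq_cls_iff {f g : Net d} (hf : f ∈ moderate Ω) (hg : g ∈ moderate Ω) :
    cls f hf = cls g hg ↔ IsNegligible Ω (f - g) :=
  Ideal.Quotient.eq

theorem exists_eq_cls (u : ColombeauAlgebra Ω) :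
    ∃ (f : Net d) (hf : f ∈ moderate Ω), u = cls f hf := by
  obtain ⟨⟨f, hf⟩, rfl⟩ := Ideal.Quotient.mk_surjective u
  exact ⟨f, hf, rfl⟩

/-- Elements of the Colombeau algebra are determined by their restrictions to a covering. -/
theorem IsCovering.ext (hU : IsCovering Ω U) {u v : ColombeauAlgebra Ω}
    (h : ∀ l, restriction (hU.le l) u = restriction (hU.le l) v) : u = v := by
  obtain ⟨f, hf, rfl⟩ := exists_eq_cls u
  obtain ⟨g, hg, rfl⟩ := exists_eq_cls v
  rw [cls_eq_cls_iff]
  refine isNegligible_of_cover hU.covers fun l => ?_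
  exact (cls_eq_cls_iff (hf.restrict (hU.le l)) (hg.restrict (hU.le l))).1 (h l)

/-- Separatedness of the sheaf gives uniqueness, so exhibiting one solution settles the
characterization. -/
theorem isGluedFrom_iff (hU : IsCovering Ω U) {N : L → Distribution Ω ℂ ⊤ → Net d}
    {u : Distribution Ω ℂ ⊤ → ColombeauAlgebra Ω} (hu : IsGluedFrom hU N u)
    (v : Distribution Ω ℂ ⊤ → ColombeauAlgebra Ω) : IsGluedFrom hU N v ↔ v = u := by
  refine ⟨fun hv => funext fun T => hU.ext fun l => ?_, fun h => h ▸ hu⟩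
  obtain ⟨_, h1⟩ := hu l T
  obtain ⟨_, h2⟩ := hv l T
  rw [h1, h2]

/-- The embedding `T ↦ [((κ_ε T) * θ_ε)]` of the distributions into the Colombeau algebra. -/
noncomputable def embedding (ρ : SchwartzMap (Space d) ℂ) (χ : Space d → ℝ)
    (κ : Eps → Space d → ℝ)
    (h : ∀ T : Distribution Ω ℂ ⊤, cutConv κ (thetaNet ρ χ) T ∈ moderate Ω) :
    Distribution Ω ℂ ⊤ →ₗ[ℂ] ColombeauAlgebra Ω where
  toFun T := cls _ (h T)
  map_add' S T := by
    have e : cutConv κ (thetaNet ρ χ) (S + T)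
        = cutConv κ (thetaNet ρ χ) S + cutConv κ (thetaNet ρ χ) T := by
      funext ε y
      exact pairing_add_left S T _
    have : (⟨_, h (S + T)⟩ : moderate Ω) = ⟨_, h S⟩ + ⟨_, h T⟩ := Subtype.ext e
    unfold cls
    rw [this]
    rfl
  map_smul' c T := by
    have e : cutConv κ (thetaNet ρ χ) (c • T) = c • cutConv κ (thetaNet ρ χ) T := by
      funext ε y
      exact pairing_smul_left c T _
    have : (⟨_, h (c • T)⟩ : moderate Ω) = c • ⟨_, h T⟩ := Subtype.ext e
    unfold cls
    rw [this]
    rfl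

end Main

end Colombeau

theorem mainTheorem1 {d : ℕ} (Ω : Opens (Colombeau.Space d))
    (ρ : SchwartzMap (Colombeau.Space d) ℂ) (hρ : Colombeau.IsMollifier ρ)
    (χ : Colombeau.Space d → ℝ) (hχ : Colombeau.IsCutoff χ)
    (κ : Colombeau.Eps → Colombeau.Space d → ℝ) (hκ : Colombeau.IsCutoffNet Ω κ)
    {L : Type*} (U : L → Opens (Colombeau.Space d)) (hU : Colombeau.IsCovering Ω U)
    (ψ : L → Colombeau.Space d → ℝ) (hψ : Colombeau.IsPlateau Ω U ψ)
    {M : Type*} (V : M → Opens (Colombeau.Space d)) (hV : Colombeau.IsCovering Ω V)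
    (e : M → Colombeau.Eps)
    (he : Colombeau.IsThreshold Ω (Colombeau.thetaNet ρ χ) V e) :
    ∃ ιA ιS ιS' : Distribution Ω ℂ ⊤ →ₗ[ℂ] Colombeau.ColombeauAlgebra Ω,
      (∀ u, Colombeau.IsIotaA ρ hU ψ u ↔ u = ιA) ∧
      (∀ u, Colombeau.IsIotaS ρ χ κ u ↔ u = ιS) ∧
      (∀ u, Colombeau.IsIotaS' ρ χ hV e u ↔ u = ιS') ∧
      ιA = ιS ∧ ιS = ιS' := by
  have hmod : ∀ T, Colombeau.cutConv κ (Colombeau.thetaNet ρ χ) T ∈ Colombeau.moderate Ω :=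
    Colombeau.isModerate_cutConv_thetaNet hχ hκ hU hψ
  let ι := Colombeau.embedding ρ χ κ hmod
  -- One map serves as all three, so the equalities hold by `rfl`; the content is that it satisfies
  -- each of the three prescriptions.
  refine ⟨ι, ι, ι, Colombeau.isGluedFrom_iff hU fun l T => ?_, fun u => ?_,
    Colombeau.isGluedFrom_iff hV fun μ T => ?_, rfl, rfl⟩
  · refine ⟨Colombeau.isModerate_cutConv_rhoNet hψ T l, ?_⟩
    exact (Colombeau.cls_eq_cls_iff _ _).2 (Colombeau.isNegligible_cutConv_sub hχ hκ hU hψ T l)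
  · refine ⟨fun h => funext fun T => (h T).2, ?_⟩
    rintro rfl T
    exact ⟨hmod T, rfl⟩
  · refine ⟨Colombeau.isModerate_localNet hχ hκ hV he (hmod T) μ, ?_⟩
    exact (Colombeau.cls_eq_cls_iff _ _).2
      (Colombeau.isNegligible_cutConv_sub_localNet hχ hκ hV he T μ)
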